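/- Model. Fix an antenna height difference $L>0$, a transmission power $P>0$, a noise power $P_N\ge 0$, a constant $q>0$ (e.g. $q=3.5$), a number $N\ge1$ of pieces, breakpoints $L<d_1<\dots<d_{N-1}$, constants $A_n^{\mathrm L},A_n^{\mathrm{NL}},\alpha_n^{\mathrm L},\alpha_n^{\mathrm{NL}}>0$ and line-of-sight (LoS) probability functions $\mathrm{Pr}_n^{\mathrm L}$, $1\le n\le N$. The $n$-th piece is used for $d_{n-1}<w\le d_n$ (the first one for $L\le w\le d_1$, the last one for $w>d_{N-1}$); on it put $\zeta^{\mathrm L}(w)=\zeta_n^{\mathrm L}(w)=A_n^{\mathrm L}w^{-\alpha_n^{\mathrm L}}$, $\zeta^{\mathrm{NL}}(w)=A_n^{\mathrm{NL}}w^{-\alpha_n^{\mathrm{NL}}}$ and $\mathrm{Pr}^{\mathrm L}(w)=\mathrm{Pr}_n^{\mathrm L}(w)\in[0,1]$, where $\mathrm{Pr}_n^{\mathrm L}$ is non-increasing on the range of its piece, and $\mathrm{Pr}_1^{\mathrm L}(w)>0$ for some $w>L$ in the range of the first piece. Assume that $\zeta^{\mathrm L}(w)\le\zeta_1^{\mathrm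 L}(L)$ and $\zeta^{\mathrm{NL}}(w)\le\zeta_1^{\mathrm L}(L)$ for all $w\ge L$ (an LoS link of the minimal length $L$ is the strongest link). For $\lambda,\rho>0$ the base stations (BSs) form a homogeneous Poisson point process $\Phi$ on the plane with density $\lambda$, and the active BSs a subset $\tilde\Phi\subseteq\Phi$ that is a homogeneous Poisson point process with density $\tilde\lambda=\lambda\bigl[1-(1+\frac{\rho}{q\lambda})^{-q}\bigr]$. The typical user is at the origin. Given $\Phi$ and $\tilde\Phi$, the link to a BS at planar distance $r$, of length $w=\sqrt{r^2+L^2}$, has path loss $\zeta=\zeta^{\mathrm L}(w)$ with probability $\mathrm{Pr}^{\mathrm L}(w)$ and $\zeta=\zeta^{\mathrm{NL}}(w)$ otherwise, and an exponentially distributed channel gain of mean $1$, all independently. The user is served by the BS $b_o\in\Phi$ with the largest $\zeta$. With $h$ the channel gain of $b_o$ and $\zeta$ its path loss, $\mathrm{SINR}=P\zeta h/(I_{\mathrm{agg}}+P_N)$, where $I_{\mathrm{agg}}=\sum_{b_i\in\tilde\Phi\setminus\{b_o\}}P\beta_ig_i$ with $\beta_i$ and $g_i$ the path loss and the channel gain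 of $b_i$. Let $p^{\mathrm{cov}}(\lambda,\rho,\gamma)=\Pr[\mathrm{SINR}>\gamma]$. Lemma 2. Let $\gamma>0$, put $s=\gamma/(P\zeta_1^{\mathrm L}(L))$ and $$c(\gamma)=\exp\Bigl(-\frac{P_N\gamma}{P\zeta_1^{\mathrm L}(L)}\Bigr),$$ $$g(\gamma)=\exp\Bigl(-2\pi\int_0^\infty\frac{\mathrm{Pr}^{\mathrm L}(\sqrt{u^2+L^2})\,u}{1+\bigl(sP\zeta^{\mathrm L}(\sqrt{u^2+L^2})\bigr)^{-1}}\,du\Bigr)\exp\Bigl(-2\pi\int_0^\infty\frac{\bigl[1-\mathrm{Pr}^{\mathrm L}(\sqrt{u^2+L^2})\bigr]u}{1+\bigl(sP\zeta^{\mathrm{NL}}(\sqrt{u^2+L^2})\bigr)^{-1}}\,du\Bigr),$$ where both integrals are assumed to be finite. Then for every $\rho>0$ $$\lim_{\lambda\to+\infty}p^{\mathrm{cov}}(\lambda,\rho,\gamma)=c(\gamma)\,g(\gamma)^{\rho},$$ and for fixed $L$ and $\gamma$ this limit is strictly decreasing in $\rho\in(0,\infty)$. -/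

import Mathlib

open MeasureTheory ProbabilityTheory Filter Topology Set

noncomputable section

namespace SmallCell

/-- The plane in which base stations (BSs) are deployed; the typical user (UE) is at the origin. -/
abbrev Plane : Type := EuclideanSpace ℝ (Fin 2)

/-- The constants of the wireless model: the antenna height difference `L`, the BS transmission
power `P`, the noise power `PN`, the constant `q` in the density of active BSs, and the
multi-piece path loss model with `n + 1` pieces and `n` breakpoints. Pieces are indexed from `0`. -/
structure Params where
  /-- absolute BS-to-UE antenna height difference -/
  L : ℝ
  /-- BS transmission power -/
  P : ℝ
  /-- noise power -/
  PN : ℝ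
  /-- constant in the formula for the density of active BSs -/
  q : ℝ
  /-- number of breakpoints, one less than the number of pieces -/
  n : ℕ
  /-- breakpoints -/
  d : Fin n → ℝ
  /-- LoS reference path losses -/
  AL : Fin (n + 1) → ℝ
  /-- NLoS reference path losses -/
  ANL : Fin (n + 1) → ℝ
  /-- LoS path loss exponents -/
  αL : Fin (n + 1) → ℝ
  /-- NLoS path loss exponents -/
  αNL : Fin (n + 1) → ℝ
  /-- pieces of the LoS probability function -/
  prPiece : Fin (n + 1) → ℝ → ℝ

namespace Params

variable (p : Params)

/-- The piece used at 3D distance `w`: the number of breakpoints strictly below `w`, that is,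
the first piece for `w ≤ d₁`, the second one for `d₁ < w ≤ d₂`, ..., the last one beyond all
breakpoints. -/
def piece (w : ℝ) : Fin (p.n + 1) :=
  ⟨(Finset.univ.filter (fun k : Fin p.n => p.d k < w)).card,
    Nat.lt_succ_of_le ((Finset.card_le_univ _).trans_eq (Fintype.card_fin p.n))⟩

/-- LoS path loss at 3D distance `w`. -/
def zetaL (w : ℝ) : ℝ := p.AL (p.piece w) * w ^ (-p.αL (p.piece w))

/-- NLoS path loss at 3D distance `w`. -/
def zetaNL (w : ℝ) : ℝ := p.ANL (p.piece w) * w ^ (-p.αNL (p.piece w))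

/-- Probability that a link of 3D length `w` is LoS. -/
def prL (w : ℝ) : ℝ := p.prPiece (p.piece w) w

/-- The first-piece LoS path loss function. -/
def zetaOneL (w : ℝ) : ℝ := p.AL 0 * w ^ (-p.αL 0)

/-- 3D distance of a BS and a UE at 2D distance `r`. -/
def dist3 (r : ℝ) : ℝ := Real.sqrt (r ^ 2 + p.L ^ 2)

/-- Standing assumptions on the constants of the model. -/
structure Valid : Prop where
  L_pos : 0 < p.L
  P_pos : 0 < p.P
  PN_nonneg : 0 ≤ p.PN
  q_pos : 0 < p.q
  d_strictMono : StrictMono p.d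
  L_lt_d : ∀ k, p.L < p.d k
  AL_pos : ∀ k, 0 < p.AL k
  ANL_pos : ∀ k, 0 < p.ANL k
  αL_pos : ∀ k, 0 < p.αL k
  αNL_pos : ∀ k, 0 < p.αNL k
  /-- `prL` is a probability -/
  prL_mem : ∀ w, p.L ≤ w → p.prL w ∈ Icc (0 : ℝ) 1
  /-- on the range of each piece, the LoS probability is decreasing -/
  prL_anti : ∀ w₁ w₂, p.L ≤ w₁ → w₁ ≤ w₂ → p.piece w₁ = p.piece w₂ → p.prL w₂ ≤ p.prL w₁
  /-- LoS links occur at some distance in the range of the first piece -/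
  prL_pos : ∃ w, p.L < w ∧ p.piece w = 0 ∧ 0 < p.prL w
  /-- an LoS link of the minimal length `L` is the strongest possible link -/
  zetaL_le : ∀ w, p.L ≤ w → p.zetaL w ≤ p.zetaOneL p.L
  zetaNL_le : ∀ w, p.L ≤ w → p.zetaNL w ≤ p.zetaOneL p.L

/-- Density of the active BSs when BSs have density `lam` and UEs have density `rho`. -/
def activeDensity (lam rho : ℝ) : ℝ :=
  lam * (1 - 1 / (1 + rho / (p.q * lam)) ^ p.q)

/-- `s = γ / (P ζ₁ᴸ(L))`. -/
def s (γ : ℝ) : ℝ := γ / (p.P * p.zetaOneL p.L)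

/-- Integrand of the LoS interference integral. -/
def losIntegrand (γ u : ℝ) : ℝ :=
  p.prL (p.dist3 u) * u / (1 + (p.s γ * p.P * p.zetaL (p.dist3 u))⁻¹)

/-- Integrand of the NLoS interference integral. -/
def nlosIntegrand (γ u : ℝ) : ℝ :=
  (1 - p.prL (p.dist3 u)) * u / (1 + (p.s γ * p.P * p.zetaNL (p.dist3 u))⁻¹)

/-- The noise factor `c(γ)`. -/
def c (γ : ℝ) : ℝ := Real.exp (-(p.PN * γ / (p.P * p.zetaOneL p.L)))

/-- The interference factor `g(γ)`. -/
def g (γ : ℝ) : ℝ :=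
  Real.exp (-2 * Real.pi * ∫ u in Ioi (0 : ℝ), p.losIntegrand γ u) *
    Real.exp (-2 * Real.pi * ∫ u in Ioi (0 : ℝ), p.nlosIntegrand γ u)

end Params

/-- `Φ` is a homogeneous Poisson point process on the plane with density `lam`: the numbers of
points in pairwise disjoint bounded Borel sets are independent and Poisson distributed, with mean
`lam` times the area. -/
def IsHPPP {Ω : Type*} [MeasurableSpace Ω] (μ : Measure Ω) (lam : ℝ) (Φ : Ω → Set Plane) : Prop :=
  ∀ (m : ℕ) (B : Fin m → Set Plane),
    (∀ j, MeasurableSet (B j)) → (∀ j, Bornology.IsBounded (B j)) →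
    Pairwise (fun i j => Disjoint (B i) (B j)) →
    ∀ k : Fin m → ℕ,
      μ {ω | ∀ j, (Φ ω ∩ B j).encard = (k j : ℕ∞)} =
        ∏ j, ENNReal.ofReal (Real.exp (-(lam * volume.real (B j))) *
          (lam * volume.real (B j)) ^ k j / (k j).factorial)

/-- The random elements of a network, on a sample space `Ω`. -/
structure Network (Ω : Type*) where
  /-- enumeration of the BS locations -/
  bs : ℕ → Ω → Plane
  /-- whether a BS is active -/
  active : ℕ → Ω → Bool
  /-- uniform variables which decide whether the link of a BS to the typical UE is LoS -/
  unif : ℕ → Ω → ℝ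
  /-- fading gain of the link of a BS to the typical UE -/
  fading : ℕ → Ω → ℝ

namespace Network

variable {Ω : Type*} (N : Network Ω) (p : Params)

/-- The set of all BSs. -/
def bsSet (ω : Ω) : Set Plane := {x | ∃ i, N.bs i ω = x}

/-- The set of active BSs. -/
def activeSet (ω : Ω) : Set Plane := {x | ∃ i, N.active i ω = true ∧ N.bs i ω = x}

/-- 3D distance of a BS to the typical UE. -/
def dist (i : ℕ) (ω : Ω) : ℝ := p.dist3 ‖N.bs i ω‖

/-- Path loss of the link of a BS to the typical UE: given its 3D length `w`, the link is LoS
with probability `prL w`. -/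
def pathLoss (i : ℕ) (ω : Ω) : ℝ :=
  if N.unif i ω < p.prL (N.dist p i ω) then p.zetaL (N.dist p i ω) else p.zetaNL (N.dist p i ω)

/-- The BS serving the typical UE: the one with the largest average received power. A maximizer
exists and is unique almost surely; otherwise the convention does not matter. -/
def serving (ω : Ω) : ℕ := sInf {i | ∀ j, N.pathLoss p j ω ≤ N.pathLoss p i ω}

open Classical in
/-- Aggregate interference at the typical UE, from the active BSs other than the serving one. -/
def interference (ω : Ω) : ENNReal :=
  ∑' i, if N.active i ω = true ∧ i ≠ N.serving p ω then
    ENNReal.ofReal (p.P * N.pathLoss p i ω * N.fading i ω) else 0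

/-- SINR of the typical UE. -/
def sinr (ω : Ω) : ENNReal :=
  ENNReal.ofReal (p.P * N.pathLoss p (N.serving p ω) ω * N.fading (N.serving p ω) ω) /
    (N.interference p ω + ENNReal.ofReal p.PN)

/-- Coverage probability: the probability that the SINR of the typical UE exceeds `γ`. -/
def pcov [MeasurableSpace Ω] (μ : Measure Ω) (γ : ℝ) : ℝ :=
  μ.real {ω | ENNReal.ofReal γ < N.sinr p ω}

/-- The probabilistic model with BS density `lam` and UE density `rho`: BSs and active BSs are
Poisson processes; given these, the links to the typical UE are independently LoS or NLoS, and
undergo independent Rayleigh fading with mean power one. -/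
structure IsModel [MeasurableSpace Ω] (μ : Measure Ω) (lam rho : ℝ) : Prop where
  measurable_bs : ∀ i, Measurable (N.bs i)
  measurable_active : ∀ i, Measurable (N.active i)
  measurable_unif : ∀ i, Measurable (N.unif i)
  measurable_fading : ∀ i, Measurable (N.fading i)
  /-- the enumeration is without repetition -/
  bs_injective : ∀ ω, Function.Injective (fun i => N.bs i ω)
  bs_poisson : IsHPPP μ lam N.bsSet
  active_poisson : IsHPPP μ (p.activeDensity lam rho) N.activeSet
  unif_law : ∀ i, μ.map (N.unif i) = volume.restrict (Icc (0 : ℝ) 1)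
  fading_law : ∀ i, μ.map (N.fading i) = expMeasure 1
  unif_indep_fading : ∀ i, IndepFun (N.unif i) (N.fading i) μ
  marks_indep : iIndepFun (fun i ω => (N.unif i ω, N.fading i ω)) μ
  /-- the marks are independent of the locations and of the activity of the BSs -/
  marks_indep_bs : IndepFun (fun ω i => (N.bs i ω, N.active i ω))
    (fun ω i => (N.unif i ω, N.fading i ω)) μ

end Network

end SmallCell

end

/-! As `λ → ∞` the base stations crowd around the user, so that the path loss of the serving link is
within any factor `κ > 1` of the largest possible one, `ζ₁ᴸ(L)`, with probability tending to one.
The density of the active process, however, only tends to `ρ`, so that with probability tending to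
one no active base station is close enough to be the serving one. The SINR then exceeds `γ`
essentially when an independent exponential gain exceeds `s (I + P_N)`, where `I` is the shot noise
of a Poisson process of density `ρ`; this has probability `E exp (-s (I + P_N))`, and the Laplace
functional of the Poisson process evaluates it as `c(γ) g(γ) ^ ρ`. The factor `κ` makes this a lower
bound with a threshold multiplied by `κ`, and Jensen's inequality `E Z ^ κ ≥ (E Z) ^ κ` bounds it by
a power of the same Laplace transform; then `κ → 1`. The limit decreases strictly in `ρ` because
`g(γ) < 1`, the LoS integrand being positive near the minimal link length. -/

noncomputable section

namespace SmallCell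

open scoped ENNReal

section ExpNeg

/-- `exp (-x)` as a function on the extended nonnegative reals, with `exp (-∞) = 0`; the Laplace
transform of an extended nonnegative random variable is the integral of its `expNeg`. -/
def expNeg (x : ℝ≥0∞) : ℝ≥0∞ := EReal.exp (-(x : EReal))

/-- `-log z` as a function on the extended nonnegative reals, the inverse of `expNeg`; it is
truncated to `0` for `z ≥ 1`. -/
def negLog (z : ℝ≥0∞) : ℝ≥0∞ := (-(ENNReal.log z)).toENNReal

lemma continuous_expNeg : Continuous expNeg :=
  ENNReal.continuous_exp.comp (continuous_neg.comp continuous_coe_ennreal_ereal)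

@[fun_prop]
lemma measurable_expNeg : Measurable expNeg := continuous_expNeg.measurable

@[fun_prop]
lemma measurable_negLog : Measurable negLog :=
  measurable_ereal_toENNReal.comp (measurable_neg.comp measurable_id.ennreal_log)

lemma antitone_expNeg : Antitone expNeg := fun _ _ h =>
  EReal.exp_monotone (EReal.neg_le_neg_iff.2 (EReal.coe_ennreal_le_coe_ennreal_iff.2 h))

@[simp] lemma expNeg_zero : expNeg 0 = 1 := by simp [expNeg]

@[simp] lemma expNeg_top : expNeg ∞ = 0 := by simp [expNeg]

@[simp] lemma negLog_one : negLog 1 = 0 := by simp [negLog]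

lemma expNeg_le_one (x : ℝ≥0∞) : expNeg x ≤ 1 :=
  expNeg_zero ▸ antitone_expNeg zero_le

lemma expNeg_add (x y : ℝ≥0∞) : expNeg (x + y) = expNeg x * expNeg y := by
  rw [expNeg, expNeg, expNeg, ← EReal.exp_add, EReal.coe_ennreal_add,
    EReal.neg_add (by simp) (by simp), sub_eq_add_neg]

lemma expNeg_ofReal {t : ℝ} (ht : 0 ≤ t) :
    expNeg (ENNReal.ofReal t) = ENNReal.ofReal (Real.exp (-t)) := by
  rw [expNeg, EReal.coe_ennreal_ofReal, max_eq_left ht, ← EReal.coe_neg, EReal.exp_coe]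

lemma expNeg_sum {ι : Type*} (s : Finset ι) (f : ι → ℝ≥0∞) :
    expNeg (∑ i ∈ s, f i) = ∏ i ∈ s, expNeg (f i) := by
  classical
  induction s using Finset.induction_on with
  | empty => simp
  | insert a s ha ih => rw [Finset.sum_insert ha, Finset.prod_insert ha, expNeg_add, ih]

lemma expNeg_natCast_mul (n : ℕ) (x : ℝ≥0∞) : expNeg (n * x) = expNeg x ^ n := by
  simpa using expNeg_sum (Finset.range n) fun _ => x

lemma expNeg_negLog {z : ℝ≥0∞} (hz : z ≤ 1) : expNeg (negLog z) = z := by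
  have h : (0 : EReal) ≤ -(ENNReal.log z) := by
    rw [EReal.le_neg, neg_zero]
    exact ENNReal.log_le_zero_iff.2 hz
  rw [expNeg, negLog, EReal.coe_toENNReal h, neg_neg, ENNReal.exp_log]

lemma tendsto_prod_expNeg (f : ℕ → ℝ≥0∞) :
    Tendsto (fun n => ∏ i ∈ Finset.range n, expNeg (f i)) atTop (𝓝 (expNeg (∑' i, f i))) := by
  simp_rw [← expNeg_sum]
  exact (continuous_expNeg.tendsto _).comp (ENNReal.tendsto_nat_tsum f)

lemma lintegral_expNeg_le_one {α : Type*} [MeasurableSpace α] {μ : Measure α}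
    [IsProbabilityMeasure μ] (f : α → ℝ≥0∞) : ∫⁻ a, expNeg (f a) ∂μ ≤ 1 :=
  (lintegral_mono fun a => expNeg_le_one (f a)).trans (by simp)

lemma tendsto_lintegral_of_le_one {α : Type*} [MeasurableSpace α] {μ : Measure α}
    [IsFiniteMeasure μ] {F : ℕ → α → ℝ≥0∞} {f : α → ℝ≥0∞} (hF : ∀ n, Measurable (F n))
    (hF_le : ∀ n a, F n a ≤ 1) (hlim : ∀ a, Tendsto (fun n => F n a) atTop (𝓝 (f a))) :
    Tendsto (fun n => ∫⁻ a, F n a ∂μ) atTop (𝓝 (∫⁻ a, f a ∂μ)) :=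
  tendsto_lintegral_of_dominated_convergence (fun _ => 1) hF
    (fun n => ae_of_all _ (hF_le n)) (by simp) (ae_of_all _ hlim)

lemma lintegral_expNeg_tsum_of_iIndepFun {Ω : Type*} [MeasurableSpace Ω] {μ : Measure Ω}
    [IsProbabilityMeasure μ] {Y : ℕ → Ω → ℝ≥0∞} (hY : ∀ i, Measurable (Y i))
    (hind : iIndepFun Y μ) :
    ∫⁻ ω, expNeg (∑' i, Y i ω) ∂μ = expNeg (∑' i, negLog (∫⁻ ω, expNeg (Y i ω) ∂μ)) := by
  have hmeas : ∀ i, Measurable fun ω => expNeg (Y i ω) := fun i => measurable_expNeg.comp (hY i)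
  have hpartial : ∀ n, ∫⁻ ω, ∏ i ∈ Finset.range n, expNeg (Y i ω) ∂μ =
      ∏ i ∈ Finset.range n, expNeg (negLog (∫⁻ ω, expNeg (Y i ω) ∂μ)) := fun n => by
    simp_rw [expNeg_negLog (lintegral_expNeg_le_one _)]
    exact lintegral_prod_eq_prod_lintegral_of_indepFun (Finset.range n) _
      (hind.comp (fun _ => expNeg) fun _ => measurable_expNeg) hmeas
  refine tendsto_nhds_unique (tendsto_lintegral_of_le_one
    (fun n => Finset.measurable_prod _ fun i _ => hmeas i)
    (fun n ω => Finset.prod_le_one' fun i _ => expNeg_le_one _)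
    fun ω => tendsto_prod_expNeg _) ?_
  simp_rw [hpartial]
  exact tendsto_prod_expNeg _

end ExpNeg

section PoissonDistribution

lemma tsum_poisson_mul_pow {t : ℝ} (ht : 0 ≤ t) {z : ℝ≥0∞} (hz : z ≤ 1) :
    ∑' k : ℕ, ENNReal.ofReal (Real.exp (-t) * t ^ k / k.factorial) * z ^ k =
      expNeg (ENNReal.ofReal t * (1 - z)) := by
  lift z to NNReal using (hz.trans_lt ENNReal.one_lt_top).ne
  have hz' : (z : ℝ) ≤ 1 := by exact_mod_cast hz
  have hterm : ∀ k : ℕ, ENNReal.ofReal (Real.exp (-t) * t ^ k / k.factorial) * (z : ℝ≥0∞) ^ k =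
      ENNReal.ofReal (Real.exp (-t) * ((t * z) ^ k / k.factorial)) := by
    intro k
    rw [← ENNReal.ofReal_coe_nnreal, ← ENNReal.ofReal_pow z.coe_nonneg,
      ← ENNReal.ofReal_mul (by positivity)]
    congr 1
    ring
  have hsum : HasSum (fun k : ℕ => Real.exp (-t) * ((t * z) ^ k / k.factorial))
      (Real.exp (-t) * Real.exp (t * z)) := by
    simpa only [← Real.exp_eq_exp_ℝ] using
      (NormedSpace.expSeries_div_hasSum_exp (t * (z : ℝ))).mul_left (Real.exp (-t))
  have hexponent : ENNReal.ofReal t * (1 - (z : ℝ≥0∞)) = ENNReal.ofReal (t * (1 - z)) := by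
    rw [ENNReal.ofReal_mul ht, ENNReal.ofReal_sub _ z.coe_nonneg, ENNReal.ofReal_one,
      ENNReal.ofReal_coe_nnreal]
  rw [tsum_congr hterm, ← ENNReal.ofReal_tsum_of_nonneg (fun k => by positivity) hsum.summable,
    hsum.tsum_eq, hexponent, expNeg_ofReal (mul_nonneg ht (by linarith)), ← Real.exp_add]
  congr 2
  ring

lemma tsum_pi_prod {n : ℕ} (f : Fin n → ℕ → ℝ≥0∞) :
    ∑' k : Fin n → ℕ, ∏ j, f j (k j) = ∏ j, ∑' i, f j i := by
  induction n with
  | zero => simp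
  | succ n ih =>
    rw [← (Fin.consEquiv fun _ => ℕ).tsum_eq, ENNReal.tsum_prod', Fin.prod_univ_succ, ← ih]
    simp [Fin.prod_univ_succ, Fin.consEquiv, ENNReal.tsum_mul_left, ENNReal.tsum_mul_right]

end PoissonDistribution

section PointMeasure

variable {Ω X : Type*} {act : ℕ → Ω → Bool} {x : ℕ → Ω → X}

/-- The set of the points `x i ω` which are retained by `act`. -/
def pointSet (act : ℕ → Ω → Bool) (x : ℕ → Ω → X) (ω : Ω) : Set X :=
  {y | ∃ i, act i ω = true ∧ x i ω = y}

/-- The random counting measure of the points `x i ω` which are retained by `act`; a point listed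
several times is counted with multiplicity. -/
def pointMeasure [MeasurableSpace X] (act : ℕ → Ω → Bool) (x : ℕ → Ω → X) (ω : Ω) : Measure X :=
  Measure.sum fun i => if act i ω = true then Measure.dirac (x i ω) else 0

variable [MeasurableSpace X]

lemma lintegral_pointMeasure {f : X → ℝ≥0∞} (hf : Measurable f) (ω : Ω) :
    ∫⁻ y, f y ∂pointMeasure act x ω = ∑' i, if act i ω = true then f (x i ω) else 0 := by
  rw [pointMeasure, lintegral_sum_measure]
  refine tsum_congr fun i => ?_
  split_ifs
  · exact lintegral_dirac' _ hf
  · exact lintegral_zero_measure _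

lemma pointMeasure_apply {B : Set X} (hB : MeasurableSet B) (ω : Ω) :
    pointMeasure act x ω B = {i | act i ω = true ∧ x i ω ∈ B}.encard := by
  classical
  rw [← lintegral_indicator_one hB, lintegral_pointMeasure (measurable_one.indicator hB),
    ← ENNReal.tsum_set_one, tsum_subtype _ fun _ => (1 : ℝ≥0∞)]
  refine tsum_congr fun i => ?_
  by_cases ha : act i ω = true <;> by_cases hb : x i ω ∈ B <;> simp [ha, hb]

lemma pointMeasure_apply_eq_zero_iff {B : Set X} (hB : MeasurableSet B) {ω : Ω} :
    pointMeasure act x ω B = 0 ↔ ∀ i, act i ω = true → x i ω ∉ B := by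
  rw [pointMeasure_apply hB, ENat.toENNReal_eq_zero, Set.encard_eq_zero, eq_empty_iff_forall_notMem]
  simp

lemma encard_pointSet_inter {ω : Ω} (hinj : Function.Injective fun i => x i ω) {B : Set X}
    (hB : MeasurableSet B) : ((pointSet act x ω ∩ B).encard : ℝ≥0∞) = pointMeasure act x ω B := by
  have himage : pointSet act x ω ∩ B = (fun i => x i ω) '' {i | act i ω = true ∧ x i ω ∈ B} := by
    ext y
    constructor
    · rintro ⟨⟨i, hi, rfl⟩, hyB⟩
      exact ⟨i, ⟨hi, hyB⟩, rfl⟩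
    · rintro ⟨i, ⟨hi, hyB⟩, rfl⟩
      exact ⟨⟨i, hi, rfl⟩, hyB⟩
  rw [himage, hinj.encard_image, pointMeasure_apply hB]

lemma pairwise_disjoint_pointMeasure_eq {ι : Type*} {B : ι → Set X} :
    Pairwise (Function.onFun Disjoint
      fun k : ι → ℕ => {ω : Ω | ∀ j, pointMeasure act x ω (B j) = k j}) :=
  fun k l hkl => Set.disjoint_left.2 fun ω hk hl => hkl <| funext fun j => by
    exact_mod_cast (hk j).symm.trans (hl j)

variable [MeasurableSpace Ω]

lemma measurable_lintegral_pointMeasure (hact : ∀ i, Measurable (act i))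
    (hx : ∀ i, Measurable (x i)) {f : X → ℝ≥0∞} (hf : Measurable f) :
    Measurable fun ω => ∫⁻ y, f y ∂pointMeasure act x ω := by
  simp_rw [lintegral_pointMeasure hf]
  exact Measurable.tsum fun i => Measurable.ite (hact i (measurableSet_singleton true))
    (hf.comp (hx i)) measurable_const

lemma measurable_pointMeasure (hact : ∀ i, Measurable (act i)) (hx : ∀ i, Measurable (x i)) :
    Measurable (pointMeasure act x) :=
  Measure.measurable_of_measurable_coe _ fun B hB => by
    simpa only [lintegral_indicator_one hB] using
      measurable_lintegral_pointMeasure hact hx (measurable_one.indicator hB)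

end PointMeasure

lemma tendsto_setLIntegral_of_monotone {X : Type*} [MeasurableSpace X] {ν : Measure X}
    {s : ℕ → Set X} (hs : ∀ n, MeasurableSet (s n)) (hs_mono : Monotone s)
    (hs_univ : ⋃ n, s n = univ) {F : ℕ → X → ℝ≥0∞} {f : X → ℝ≥0∞} (hF : ∀ n, Measurable (F n))
    (hF_mono : Monotone F) (hlim : ∀ y, Tendsto (fun n => F n y) atTop (𝓝 (f y))) :
    Tendsto (fun n => ∫⁻ y in s n, F n y ∂ν) atTop (𝓝 (∫⁻ y, f y ∂ν)) := by
  simp_rw [← lintegral_indicator (hs _)]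
  refine lintegral_tendsto_of_tendsto_of_monotone (fun n => ((hF n).indicator (hs n)).aemeasurable)
    (ae_of_all _ fun y n k hnk => ?_) (ae_of_all _ fun y => (hlim y).congr' ?_)
  · exact (indicator_le_indicator_of_subset (hs_mono hnk) (fun _ => zero_le) y).trans
      (indicator_le_indicator (hF_mono hnk y))
  · obtain ⟨n, hn⟩ := mem_iUnion.1 (hs_univ ▸ mem_univ y : y ∈ ⋃ n, s n)
    filter_upwards [eventually_ge_atTop n] with k hk
    rw [indicator_of_mem (hs_mono hk hn)]

lemma setLIntegral_comp_simpleFunc {X β : Type*} [MeasurableSpace X] (ν : Measure X)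
    (g : SimpleFunc X β) (φ : β → ℝ≥0∞) (s : Set X) :
    ∫⁻ y in s, φ (g y) ∂ν = ∑ r ∈ g.range, φ r * ν (g ⁻¹' {r} ∩ s) := by
  calc ∫⁻ y in s, φ (g y) ∂ν
      = (g.map φ).lintegral (ν.restrict s) := SimpleFunc.lintegral_eq_lintegral (g.map φ) _
    _ = ∑ r ∈ g.range, φ r * ν (g ⁻¹' {r} ∩ s) := by
        simp only [SimpleFunc.map_lintegral, Measure.restrict_apply (g.measurableSet_preimage _)]

/-- A homogeneous Poisson point process on the plane with density `lam`, presented as the points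
`x i ω` of an enumeration without repetition which are retained by `act`. -/
structure IsPoissonEnumeration {Ω : Type*} [MeasurableSpace Ω] (μ : Measure Ω) (lam : ℝ)
    (act : ℕ → Ω → Bool) (x : ℕ → Ω → Plane) : Prop where
  measurable_act : ∀ i, Measurable (act i)
  measurable_loc : ∀ i, Measurable (x i)
  injective : ∀ ω, Function.Injective fun i => x i ω
  density_nonneg : 0 ≤ lam
  isHPPP : IsHPPP μ lam (pointSet act x)

namespace IsPoissonEnumeration

variable {Ω : Type*} [MeasurableSpace Ω] {μ : Measure Ω} {act : ℕ → Ω → Bool}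
  {x : ℕ → Ω → Plane} {lam : ℝ}

lemma measurable_pointMeasure_apply (h : IsPoissonEnumeration μ lam act x) {B : Set Plane}
    (hB : MeasurableSet B) : Measurable fun ω => pointMeasure act x ω B :=
  (Measure.measurable_coe hB).comp (measurable_pointMeasure h.measurable_act h.measurable_loc)

section Counts

variable {m : ℕ} {B : Fin m → Set Plane}

lemma measure_count_eq (h : IsPoissonEnumeration μ lam act x) (hB : ∀ j, MeasurableSet (B j))
    (hbdd : ∀ j, Bornology.IsBounded (B j)) (hdisj : Pairwise fun i j => Disjoint (B i) (B j))
    (k : Fin m → ℕ) :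
    μ {ω | ∀ j, pointMeasure act x ω (B j) = k j} =
      ∏ j, ENNReal.ofReal (Real.exp (-(lam * volume.real (B j))) *
        (lam * volume.real (B j)) ^ k j / (k j).factorial) := by
  rw [← h.isHPPP m B hB hbdd hdisj k]
  congr 1
  ext ω
  refine forall_congr' fun j => ?_
  rw [← encard_pointSet_inter (h.injective ω) (hB j)]
  norm_cast

lemma measurableSet_count_eq (h : IsPoissonEnumeration μ lam act x)
    (hB : ∀ j, MeasurableSet (B j)) (k : Fin m → ℕ) :
    MeasurableSet {ω | ∀ j, pointMeasure act x ω (B j) = k j} := by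
  simp only [ofPred_forall]
  exact MeasurableSet.iInter fun j =>
    h.measurable_pointMeasure_apply (hB j) (measurableSet_singleton _)

lemma ae_exists_count_eq [IsProbabilityMeasure μ] (h : IsPoissonEnumeration μ lam act x)
    (hB : ∀ j, MeasurableSet (B j)) (hbdd : ∀ j, Bornology.IsBounded (B j))
    (hdisj : Pairwise fun i j => Disjoint (B i) (B j)) :
    ∀ᵐ ω ∂μ, ω ∈ ⋃ k : Fin m → ℕ, {ω | ∀ j, pointMeasure act x ω (B j) = k j} := by
  refine (mem_ae_iff_prob_eq_one (MeasurableSet.iUnion (h.measurableSet_count_eq hB))).2 ?_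
  rw [measure_iUnion pairwise_disjoint_pointMeasure_eq (h.measurableSet_count_eq hB)]
  simp_rw [h.measure_count_eq hB hbdd hdisj]
  rw [tsum_pi_prod fun j i => ENNReal.ofReal (Real.exp (-(lam * volume.real (B j))) *
    (lam * volume.real (B j)) ^ i / i.factorial)]
  refine Finset.prod_eq_one fun j _ => ?_
  simpa using tsum_poisson_mul_pow
    (mul_nonneg h.density_nonneg (measureReal_nonneg (s := B j))) (z := 1) le_rfl

lemma lintegral_expNeg_sum_count [IsProbabilityMeasure μ] (h : IsPoissonEnumeration μ lam act x)
    (hB : ∀ j, MeasurableSet (B j)) (hbdd : ∀ j, Bornology.IsBounded (B j))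
    (hdisj : Pairwise fun i j => Disjoint (B i) (B j)) (a : Fin m → ℝ≥0∞) :
    ∫⁻ ω, expNeg (∑ j, a j * pointMeasure act x ω (B j)) ∂μ =
      expNeg (ENNReal.ofReal lam * ∑ j, (1 - expNeg (a j)) * volume (B j)) := by
  have hvol : ∀ j, ENNReal.ofReal lam * volume (B j) = ENNReal.ofReal (lam * volume.real (B j)) :=
    fun j => by
      rw [ENNReal.ofReal_mul h.density_nonneg, Measure.real,
        ENNReal.ofReal_toReal (hbdd j).measure_lt_top.ne]
  calc ∫⁻ ω, expNeg (∑ j, a j * pointMeasure act x ω (B j)) ∂μ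
      = ∑' k : Fin m → ℕ, ∫⁻ ω in {ω | ∀ j, pointMeasure act x ω (B j) = k j},
          expNeg (∑ j, a j * pointMeasure act x ω (B j)) ∂μ := by
        rw [← lintegral_iUnion (h.measurableSet_count_eq hB) pairwise_disjoint_pointMeasure_eq,
          Measure.restrict_eq_self_of_ae_mem (h.ae_exists_count_eq hB hbdd hdisj)]
    _ = ∑' k : Fin m → ℕ, ∏ j, (ENNReal.ofReal (Real.exp (-(lam * volume.real (B j))) *
          (lam * volume.real (B j)) ^ k j / (k j).factorial) * expNeg (a j) ^ k j) := by
        refine tsum_congr fun k => ?_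
        rw [setLIntegral_congr_fun (g := fun _ => ∏ j, expNeg (a j) ^ k j)
            (h.measurableSet_count_eq hB k), setLIntegral_const, h.measure_count_eq hB hbdd hdisj,
          mul_comm, Finset.prod_mul_distrib]
        intro ω hω
        simp only [expNeg_sum]
        exact Finset.prod_congr rfl fun j _ => by rw [hω j, mul_comm, expNeg_natCast_mul]
    _ = expNeg (ENNReal.ofReal lam * ∑ j, (1 - expNeg (a j)) * volume (B j)) := by
        rw [tsum_pi_prod fun j i => ENNReal.ofReal (Real.exp (-(lam * volume.real (B j))) *
          (lam * volume.real (B j)) ^ i / i.factorial) * expNeg (a j) ^ i, Finset.mul_sum,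
          expNeg_sum]
        refine Finset.prod_congr rfl fun j _ => ?_
        rw [mul_comm (1 - _), ← mul_assoc, hvol,
          tsum_poisson_mul_pow (mul_nonneg h.density_nonneg measureReal_nonneg) (expNeg_le_one _)]

end Counts

variable [IsProbabilityMeasure μ]

lemma ae_pointMeasure_lt_top (h : IsPoissonEnumeration μ lam act x) {B : Set Plane}
    (hB : MeasurableSet B) (hbdd : Bornology.IsBounded B) :
    ∀ᵐ ω ∂μ, pointMeasure act x ω B < ∞ := by
  filter_upwards [h.ae_exists_count_eq (B := fun _ : Fin 1 => B) (fun _ => hB) (fun _ => hbdd)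
    fun i j hij => (hij (Subsingleton.elim i j)).elim] with ω hω
  obtain ⟨k, hk⟩ := mem_iUnion.1 hω
  exact (hk 0).trans_lt (ENNReal.natCast_lt_top _)

lemma lintegral_expNeg_simpleFunc (h : IsPoissonEnumeration μ lam act x)
    (g : SimpleFunc Plane ℝ≥0∞) {s : Set Plane} (hs : MeasurableSet s)
    (hbdd : Bornology.IsBounded s) :
    ∫⁻ ω, expNeg (∫⁻ y in s, g y ∂pointMeasure act x ω) ∂μ =
      expNeg (ENNReal.ofReal lam * ∫⁻ y in s, (1 - expNeg (g y))) := by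
  obtain ⟨e⟩ : Nonempty (Fin g.range.card ≃ g.range) := ⟨g.range.equivFin.symm⟩
  have hdisj : Pairwise fun i j =>
      Disjoint (g ⁻¹' {(e i : ℝ≥0∞)} ∩ s) (g ⁻¹' {(e j : ℝ≥0∞)} ∩ s) := fun i j hij =>
    Set.disjoint_left.2 fun y hi hj => hij <| e.injective <| Subtype.ext <|
      (show g y = _ from hi.1).symm.trans (show g y = _ from hj.1)
  have hsum : ∀ (ν : Measure Plane) (φ : ℝ≥0∞ → ℝ≥0∞), ∫⁻ y in s, φ (g y) ∂ν =
      ∑ j, φ (e j : ℝ≥0∞) * ν (g ⁻¹' {(e j : ℝ≥0∞)} ∩ s) := fun ν φ => by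
    rw [setLIntegral_comp_simpleFunc, ← Finset.sum_coe_sort]
    exact (e.sum_comp fun r : g.range => φ r * ν (g ⁻¹' {(r : ℝ≥0∞)} ∩ s)).symm
  have hcount := h.lintegral_expNeg_sum_count
    (fun j => (g.measurableSet_preimage {(e j : ℝ≥0∞)}).inter hs)
    (fun j => hbdd.subset inter_subset_right) hdisj fun j => (e j : ℝ≥0∞)
  rw [hsum volume fun r => 1 - expNeg r]
  simpa only [fun ω => hsum (pointMeasure act x ω) fun r => r] using hcount

lemma lintegral_expNeg_lintegral (h : IsPoissonEnumeration μ lam act x) {f : Plane → ℝ≥0∞}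
    (hf : Measurable f) :
    ∫⁻ ω, expNeg (∫⁻ y, f y ∂pointMeasure act x ω) ∂μ =
      expNeg (ENNReal.ofReal lam * ∫⁻ y, (1 - expNeg (f y))) := by
  let g : ℕ → SimpleFunc Plane ℝ≥0∞ := SimpleFunc.eapprox f
  let s : ℕ → Set Plane := fun n => Metric.ball 0 n
  have hs : ∀ n, MeasurableSet (s n) := fun n => measurableSet_ball
  have hs_mono : Monotone s := fun n k hnk => Metric.ball_subset_ball (Nat.cast_le.2 hnk)
  have hs_univ : ⋃ n, s n = univ := Metric.iUnion_ball_nat 0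
  have hg_lim : ∀ y, Tendsto (fun n => g n y) atTop (𝓝 (f y)) := SimpleFunc.tendsto_eapprox hf
  have hvolume : Tendsto (fun n => ∫⁻ y in s n, (1 - expNeg (g n y))) atTop
      (𝓝 (∫⁻ y, (1 - expNeg (f y)))) :=
    tendsto_setLIntegral_of_monotone hs hs_mono hs_univ
      (fun n => measurable_const.sub (measurable_expNeg.comp (g n).measurable))
      (fun n k hnk y => tsub_le_tsub_left (antitone_expNeg (SimpleFunc.monotone_eapprox f hnk y)) _)
      (fun y => ENNReal.Tendsto.sub tendsto_const_nhds
        ((continuous_expNeg.tendsto _).comp (hg_lim y)) (Or.inl ENNReal.one_ne_top))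
  refine tendsto_nhds_unique (tendsto_lintegral_of_le_one
    (F := fun n ω => expNeg (∫⁻ y in s n, g n y ∂pointMeasure act x ω)) (fun n => ?_)
    (fun n ω => expNeg_le_one _) fun ω => (continuous_expNeg.tendsto _).comp
      (tendsto_setLIntegral_of_monotone hs hs_mono hs_univ (fun n => (g n).measurable)
        (SimpleFunc.monotone_eapprox f) hg_lim)) ?_
  · simp_rw [← lintegral_indicator (hs n)]
    exact measurable_expNeg.comp (measurable_lintegral_pointMeasure h.measurable_act
      h.measurable_loc ((g n).measurable.indicator (hs n)))
  · simp_rw [h.lintegral_expNeg_simpleFunc (g _) (hs _) Metric.isBounded_ball]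
    exact (continuous_expNeg.tendsto _).comp
      (ENNReal.Tendsto.const_mul hvolume (Or.inr ENNReal.ofReal_ne_top))

end IsPoissonEnumeration

lemma lintegral_prodMk_of_indepFun {Ω α β : Type*} [MeasurableSpace Ω] [MeasurableSpace α]
    [MeasurableSpace β] {μ : Measure Ω} [IsFiniteMeasure μ] {A : Ω → α} {B : Ω → β}
    (hA : Measurable A) (hB : Measurable B) (hind : IndepFun A B μ) {K : α × β → ℝ≥0∞}
    (hK : Measurable K) :
    ∫⁻ ω, K (A ω, B ω) ∂μ = ∫⁻ ω, ∫⁻ ω', K (A ω, B ω') ∂μ ∂μ := by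
  rw [← lintegral_map hK (hA.prodMk hB),
    (indepFun_iff_map_prod_eq_prod_map_map hA.aemeasurable hB.aemeasurable).1 hind,
    lintegral_prod _ hK.aemeasurable, lintegral_map hK.lintegral_prod_right' hA]
  exact lintegral_congr fun ω => lintegral_map (hK.comp measurable_prodMk_left) hB

/-- The points `x i` carry independent marks `mark i` with law `ν`, which are independent of the
points and of the retention flags `act i`. -/
structure IsIndependentMarking {Ω X E : Type*} [MeasurableSpace Ω] [MeasurableSpace X]
    [MeasurableSpace E] (μ : Measure Ω) (ν : Measure E) (act : ℕ → Ω → Bool) (x : ℕ → Ω → X)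
    (mark : ℕ → Ω → E) : Prop where
  measurable_mark : ∀ i, Measurable (mark i)
  map_mark : ∀ i, μ.map (mark i) = ν
  iIndepFun_mark : iIndepFun mark μ
  indepFun : IndepFun (fun ω i => (x i ω, act i ω)) (fun ω i => mark i ω) μ

section Marking

variable {Ω X E : Type*} [MeasurableSpace Ω] [MeasurableSpace X] [MeasurableSpace E]
  {μ : Measure Ω} [IsProbabilityMeasure μ] {ν : Measure E} {act : ℕ → Ω → Bool}
  {mark : ℕ → Ω → E}

lemma IsIndependentMarking.lintegral_expNeg_tsum {x : ℕ → Ω → X}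
    (hmark : IsIndependentMarking μ ν act x mark) {F : X × E → ℝ≥0∞} (hF : Measurable F)
    (b : ℕ → Bool) (y : ℕ → X) :
    ∫⁻ ω, expNeg (∑' i, if b i = true then F (y i, mark i ω) else 0) ∂μ =
      expNeg (∑' i, if b i = true then negLog (∫⁻ e, expNeg (F (y i, e)) ∂ν) else 0) := by
  let G : ℕ → E → ℝ≥0∞ := fun i e => if b i = true then F (y i, e) else 0
  have hG : ∀ i, Measurable (G i) := fun i =>
    Measurable.ite (MeasurableSet.const _) (hF.comp measurable_prodMk_left) measurable_const
  refine (lintegral_expNeg_tsum_of_iIndepFun (fun i => (hG i).comp (hmark.measurable_mark i))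
    (hmark.iIndepFun_mark.comp G hG)).trans ?_
  congr 1
  refine tsum_congr fun i => ?_
  simp only [Function.comp_apply, G]
  split_ifs
  · rw [← hmark.map_mark i, lintegral_map (f := fun e => expNeg (F (y i, e))) (by fun_prop)
      (hmark.measurable_mark i)]
  · simp

-- Integrating out the marks turns `F` into the negative logarithm of its Laplace transform in the
-- mark, which reduces the claim to the Laplace functional of the unmarked process.
lemma IsPoissonEnumeration.lintegral_expNeg_marked {x : ℕ → Ω → Plane} {lam : ℝ}
    [IsProbabilityMeasure ν] (h : IsPoissonEnumeration μ lam act x)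
    (hmark : IsIndependentMarking μ ν act x mark) {F : Plane × E → ℝ≥0∞} (hF : Measurable F) :
    ∫⁻ ω, expNeg (∫⁻ z, F z ∂pointMeasure act (fun i ω => (x i ω, mark i ω)) ω) ∂μ =
      expNeg (ENNReal.ofReal lam * ∫⁻ y, (1 - ∫⁻ e, expNeg (F (y, e)) ∂ν)) := by
  have hX : Measurable fun ω i => (x i ω, act i ω) :=
    measurable_pi_lambda _ fun i => (h.measurable_loc i).prodMk (h.measurable_act i)
  have hM : Measurable fun ω i => mark i ω := measurable_pi_lambda _ hmark.measurable_mark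
  have hK : Measurable fun z : (ℕ → Plane × Bool) × (ℕ → E) =>
      expNeg (∑' i, if (z.1 i).2 = true then F ((z.1 i).1, z.2 i) else 0) := by
    have hact : ∀ i, Measurable fun z : (ℕ → Plane × Bool) × (ℕ → E) => (z.1 i).2 := by fun_prop
    exact measurable_expNeg.comp (Measurable.tsum fun i =>
      Measurable.ite (hact i (measurableSet_singleton true)) (by fun_prop) measurable_const)
  have hφ : Measurable fun y => negLog (∫⁻ e, expNeg (F (y, e)) ∂ν) :=
    measurable_negLog.comp (measurable_expNeg.comp hF).lintegral_prod_right'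
  calc ∫⁻ ω, expNeg (∫⁻ z, F z ∂pointMeasure act (fun i ω => (x i ω, mark i ω)) ω) ∂μ
      = ∫⁻ ω, ∫⁻ ω', expNeg (∑' i, if act i ω = true then F (x i ω, mark i ω') else 0) ∂μ ∂μ := by
        simp_rw [lintegral_pointMeasure hF]
        exact lintegral_prodMk_of_indepFun hX hM hmark.indepFun hK
    _ = ∫⁻ ω, expNeg (∫⁻ y, negLog (∫⁻ e, expNeg (F (y, e)) ∂ν) ∂pointMeasure act x ω) ∂μ := by
        refine lintegral_congr fun ω => ?_
        rw [hmark.lintegral_expNeg_tsum hF (fun i => act i ω) fun i => x i ω,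
          lintegral_pointMeasure hφ]
    _ = expNeg (ENNReal.ofReal lam * ∫⁻ y, (1 - ∫⁻ e, expNeg (F (y, e)) ∂ν)) := by
        rw [h.lintegral_expNeg_lintegral hφ]
        simp_rw [expNeg_negLog (lintegral_expNeg_le_one _)]

lemma IsPoissonEnumeration.measure_marked_eq_zero {x : ℕ → Ω → Plane} {lam : ℝ}
    [IsProbabilityMeasure ν] (h : IsPoissonEnumeration μ lam act x)
    (hmark : IsIndependentMarking μ ν act x mark) {D : Set (Plane × E)} (hD : MeasurableSet D) :
    μ {ω | pointMeasure act (fun i ω => (x i ω, mark i ω)) ω D = 0} =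
      expNeg (ENNReal.ofReal lam * (volume.prod ν) D) := by
  have hF : Measurable (D.indicator fun _ => ∞ : Plane × E → ℝ≥0∞) :=
    measurable_const.indicator hD
  have hpoint : ∀ z, expNeg (D.indicator (fun _ => ∞) z) = Dᶜ.indicator 1 z := fun z => by
    by_cases hz : z ∈ D <;> simp [hz]
  have hN : MeasurableSet {ω | pointMeasure act (fun i ω => (x i ω, mark i ω)) ω D = 0} :=
    (Measure.measurable_coe hD).comp (measurable_pointMeasure h.measurable_act fun i =>
      (h.measurable_loc i).prodMk (hmark.measurable_mark i)) (measurableSet_singleton 0)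
  calc μ {ω | pointMeasure act (fun i ω => (x i ω, mark i ω)) ω D = 0}
      = ∫⁻ ω, expNeg (∫⁻ z, D.indicator (fun _ => ∞) z
          ∂pointMeasure act (fun i ω => (x i ω, mark i ω)) ω) ∂μ := by
        rw [← lintegral_indicator_one hN]
        refine lintegral_congr fun ω => ?_
        rw [lintegral_indicator_const hD]
        by_cases h0 : pointMeasure act (fun i ω => (x i ω, mark i ω)) ω D = 0 <;>
          simp [h0, ENNReal.top_mul]
    _ = expNeg (ENNReal.ofReal lam * (volume.prod ν) D) := by
        rw [h.lintegral_expNeg_marked hmark hF, Measure.prod_apply hD]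
        congr 2
        refine lintegral_congr fun y => ?_
        simp_rw [hpoint]
        have hslice : MeasurableSet (Prod.mk y ⁻¹' D) := measurable_prodMk_left hD
        have hcompl : ∫⁻ e, Dᶜ.indicator 1 (y, e) ∂ν = ν (Prod.mk y ⁻¹' D)ᶜ :=
          lintegral_indicator_one hslice.compl
        rw [hcompl, ← prob_compl_eq_one_sub hslice.compl, compl_compl]

end Marking

namespace Params

variable (p : Params)

lemma monotone_piece : Monotone p.piece := fun _ _ h =>
  Fin.mk_le_mk.2 <| Finset.card_le_card <|
    Finset.monotone_filter_right _ fun _ _ hk => hk.trans_le h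

lemma measurable_piece : Measurable p.piece := p.monotone_piece.measurable

/-- A multi-piece power law with the breakpoints of the model; both `zetaL` and `zetaNL` are of
this form. -/
def powerLaw (A α : Fin (p.n + 1) → ℝ) (w : ℝ) : ℝ := A (p.piece w) * w ^ (-α (p.piece w))

section PowerLaw

variable {A α : Fin (p.n + 1) → ℝ}

lemma measurable_powerLaw : Measurable (p.powerLaw A α) :=
  ((measurable_of_countable A).comp p.measurable_piece).mul
    (measurable_id.pow ((measurable_of_countable fun k => -α k).comp p.measurable_piece))

lemma powerLaw_pos (hA : ∀ k, 0 < A k) {w : ℝ} (hw : 0 < w) : 0 < p.powerLaw A α w :=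
  mul_pos (hA _) (Real.rpow_pos_of_pos hw _)

lemma eventually_powerLaw_lt (hα : ∀ k, 0 < α k) {ε : ℝ} (hε : 0 < ε) :
    ∀ᶠ w in atTop, p.powerLaw A α w < ε := by
  have hpiece : ∀ k, ∀ᶠ w : ℝ in atTop, A k * w ^ (-α k) < ε := fun k => by
    have hlim := (tendsto_rpow_neg_atTop (hα k)).const_mul (A k)
    rw [mul_zero] at hlim
    exact hlim.eventually (gt_mem_nhds hε)
  filter_upwards [eventually_all.2 hpiece] with w hw using hw _

end PowerLaw

lemma continuous_dist3 : Continuous p.dist3 := by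
  unfold dist3
  fun_prop

lemma le_dist3 (r : ℝ) : p.L ≤ p.dist3 r :=
  Real.le_sqrt_of_sq_le (by nlinarith [sq_nonneg r])

lemma le_dist3_self {r : ℝ} : r ≤ p.dist3 r :=
  Real.le_sqrt_of_sq_le (by nlinarith [sq_nonneg p.L])

lemma injOn_dist3 : InjOn p.dist3 (Ici 0) := fun r hr t ht h => by
  have hsq := (Real.sqrt_inj (by positivity) (by positivity)).1 h
  exact (sq_eq_sq₀ hr ht).1 (by linarith)

/-- The path loss of the strongest possible link, an LoS link of the minimal length. -/
def peak : ℝ := p.zetaOneL p.L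

/-- The path loss of a link from a BS at `x` whose LoS state is decided by `u`. -/
def linkLoss (x : Plane) (u : ℝ) : ℝ :=
  if u < p.prL (p.dist3 ‖x‖) then p.zetaL (p.dist3 ‖x‖) else p.zetaNL (p.dist3 ‖x‖)

/-- The path loss of a link from a BS at `x` in the better of its two possible LoS states. -/
def bestLoss (x : Plane) : ℝ := max (p.zetaL (p.dist3 ‖x‖)) (p.zetaNL (p.dist3 ‖x‖))

/-- The locations from which a link with path loss at least `peak / κ` is possible. -/
def strongRegion (κ : ℝ) : Set Plane := {x | p.peak ≤ κ * p.bestLoss x}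

lemma measurable_zetaL_dist3 : Measurable fun r => p.zetaL (p.dist3 r) :=
  p.measurable_powerLaw.comp p.continuous_dist3.measurable

lemma measurable_zetaNL_dist3 : Measurable fun r => p.zetaNL (p.dist3 r) :=
  p.measurable_powerLaw.comp p.continuous_dist3.measurable

lemma measurable_bestLoss : Measurable p.bestLoss :=
  (p.measurable_zetaL_dist3.comp measurable_norm).max
    (p.measurable_zetaNL_dist3.comp measurable_norm)

lemma linkLoss_le_bestLoss (x : Plane) (u : ℝ) : p.linkLoss x u ≤ p.bestLoss x := by
  unfold linkLoss bestLoss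
  split_ifs
  exacts [le_max_left _ _, le_max_right _ _]

lemma mem_strongRegion {p : Params} {κ : ℝ} (hκ : 0 ≤ κ) {x : Plane} {u : ℝ}
    (h : p.peak ≤ κ * p.linkLoss x u) : x ∈ p.strongRegion κ :=
  h.trans (mul_le_mul_of_nonneg_left (p.linkLoss_le_bestLoss x u) hκ)

lemma measurableSet_strongRegion (κ : ℝ) : MeasurableSet (p.strongRegion κ) :=
  measurableSet_le measurable_const (p.measurable_bestLoss.const_mul κ)

namespace Valid

variable {p} (hp : p.Valid)

include hp

lemma dist3_pos (r : ℝ) : 0 < p.dist3 r := hp.L_pos.trans_le (p.le_dist3 r)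

lemma dist3_zero : p.dist3 0 = p.L := by
  simp [dist3, Real.sqrt_sq hp.L_pos.le]

lemma zetaL_pos (r : ℝ) : 0 < p.zetaL (p.dist3 r) := p.powerLaw_pos hp.AL_pos (hp.dist3_pos r)

lemma zetaNL_pos (r : ℝ) : 0 < p.zetaNL (p.dist3 r) := p.powerLaw_pos hp.ANL_pos (hp.dist3_pos r)

lemma peak_pos : 0 < p.peak := mul_pos (hp.AL_pos _) (Real.rpow_pos_of_pos hp.L_pos _)

lemma linkLoss_pos (x : Plane) (u : ℝ) : 0 < p.linkLoss x u := by
  unfold linkLoss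
  split_ifs
  exacts [hp.zetaL_pos _, hp.zetaNL_pos _]

lemma bestLoss_pos (x : Plane) : 0 < p.bestLoss x := lt_max_of_lt_left (hp.zetaL_pos _)

lemma bestLoss_le_peak (x : Plane) : p.bestLoss x ≤ p.peak :=
  max_le (hp.zetaL_le _ (p.le_dist3 _)) (hp.zetaNL_le _ (p.le_dist3 _))

lemma linkLoss_le_peak (x : Plane) (u : ℝ) : p.linkLoss x u ≤ p.peak :=
  (p.linkLoss_le_bestLoss x u).trans (hp.bestLoss_le_peak x)

lemma measurable_prL_dist3 : Measurable fun r => p.prL (p.dist3 r) := by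
  have hext : ∀ k, ∃ g : ℝ → ℝ, Antitone g ∧ EqOn p.prL g {w | p.L ≤ w ∧ p.piece w = k} :=
    fun k => AntitoneOn.exists_antitone_extension
      (fun a ha b hb hab => hp.prL_anti a b ha.1 hab (ha.2.trans hb.2.symm))
      ⟨0, forall_mem_image.2 fun w hw => (hp.prL_mem w hw.1).1⟩
      ⟨1, forall_mem_image.2 fun w hw => (hp.prL_mem w hw.1).2⟩
  choose g hg hgeq using hext
  have heq : (fun r => p.prL (p.dist3 r)) = fun r => g (p.piece (p.dist3 r)) (p.dist3 r) :=
    funext fun r => hgeq _ ⟨p.le_dist3 r, rfl⟩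
  have hg_meas : Measurable fun z : Fin (p.n + 1) × ℝ => g z.1 z.2 :=
    measurable_from_prod_countable_right fun k => (hg k).measurable
  have hdist := p.continuous_dist3.measurable
  rw [heq]
  exact hg_meas.comp ((p.measurable_piece.comp hdist).prodMk hdist)

lemma measurable_linkLoss : Measurable fun z : Plane × ℝ => p.linkLoss z.1 z.2 := by
  have hnorm : Measurable fun z : Plane × ℝ => ‖z.1‖ := measurable_fst.norm
  exact Measurable.ite (measurableSet_lt measurable_snd (hp.measurable_prL_dist3.comp hnorm))
    (p.measurable_zetaL_dist3.comp hnorm) (p.measurable_zetaNL_dist3.comp hnorm)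

lemma isBounded_strongRegion {κ : ℝ} (hκ : 0 < κ) : Bornology.IsBounded (p.strongRegion κ) := by
  have hε : 0 < p.peak / κ := div_pos hp.peak_pos hκ
  obtain ⟨R, hR⟩ := ((p.eventually_powerLaw_lt (A := p.AL) hp.αL_pos hε).and
    (p.eventually_powerLaw_lt (A := p.ANL) hp.αNL_pos hε)).exists_forall_of_atTop
  refine (Metric.isBounded_ball (x := (0 : Plane)) (r := R)).subset fun x hx => ?_
  rw [mem_ball_zero_iff]
  by_contra! hRx
  obtain ⟨hL, hNL⟩ := hR _ (hRx.trans p.le_dist3_self)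
  have hbest : p.bestLoss x < p.peak / κ := max_lt hL hNL
  exact absurd hx (not_le.2 ((lt_div_iff₀' hκ).1 hbest))

lemma volume_powerLaw_eq {A α : Fin (p.n + 1) → ℝ} (hA : ∀ k, 0 < A k) (hα : ∀ k, 0 < α k)
    (M : ℝ) : volume {x : Plane | p.powerLaw A α (p.dist3 ‖x‖) = M} = 0 := by
  have hsub : {x : Plane | p.powerLaw A α (p.dist3 ‖x‖) = M} ⊆
      ⋃ k, {x : Plane | A k * p.dist3 ‖x‖ ^ (-α k) = M} := fun x hx => mem_iUnion.2 ⟨_, hx⟩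
  refine measure_mono_null hsub (measure_iUnion_null fun k => ?_)
  rcases eq_empty_or_nonempty {x : Plane | A k * p.dist3 ‖x‖ ^ (-α k) = M} with hempty | ⟨y, hy⟩
  · rw [hempty, measure_empty]
  · refine measure_mono_null (t := Metric.sphere 0 ‖y‖) (fun x hx => ?_)
      (Measure.addHaar_sphere _ _ _)
    have hpow : p.dist3 ‖x‖ ^ (-α k) = p.dist3 ‖y‖ ^ (-α k) :=
      mul_left_cancel₀ (hA k).ne' (Eq.trans hx hy.symm)
    rw [Real.rpow_left_inj (hp.dist3_pos _).le (hp.dist3_pos _).le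
      (neg_ne_zero.2 (hα k).ne')] at hpow
    exact mem_sphere_zero_iff_norm.2 (p.injOn_dist3 (norm_nonneg _) (norm_nonneg _) hpow)

lemma volume_bestLoss_eq_peak : volume {x : Plane | p.bestLoss x = p.peak} = 0 := by
  refine measure_mono_null (t := {x : Plane | p.powerLaw p.AL p.αL (p.dist3 ‖x‖) = p.peak} ∪
    {x : Plane | p.powerLaw p.ANL p.αNL (p.dist3 ‖x‖) = p.peak}) (fun x hx => ?_)
    (measure_union_null (hp.volume_powerLaw_eq hp.AL_pos hp.αL_pos _)
      (hp.volume_powerLaw_eq hp.ANL_pos hp.αNL_pos _))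
  exact (max_choice _ _).imp (fun h => h.symm.trans hx) fun h => h.symm.trans hx

lemma tendsto_volume_strongRegion :
    Tendsto (fun κ => volume (p.strongRegion κ)) (𝓝[>] 1) (𝓝 0) := by
  have hmono : ∀ κ₁ κ₂, 1 < κ₁ → κ₁ ≤ κ₂ → p.strongRegion κ₁ ⊆ p.strongRegion κ₂ :=
    fun κ₁ κ₂ _ hκ x hx => hx.trans (mul_le_mul_of_nonneg_right hκ (hp.bestLoss_pos x).le)
  have hInter : ⋂ κ > 1, p.strongRegion κ ⊆ {x | p.bestLoss x = p.peak} := fun x hx => by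
    refine (hp.bestLoss_le_peak x).antisymm ?_
    have hlim : Tendsto (fun κ => κ * p.bestLoss x) (𝓝[>] 1) (𝓝 (1 * p.bestLoss x)) :=
      (tendsto_id.mul_const _).mono_left nhdsWithin_le_nhds
    rw [one_mul] at hlim
    exact ge_of_tendsto hlim (eventually_mem_nhdsWithin.mono fun κ hκ => mem_iInter₂.1 hx κ hκ)
  rw [← measure_mono_null hInter hp.volume_bestLoss_eq_peak]
  exact tendsto_measure_biInter_gt (fun κ _ => (p.measurableSet_strongRegion κ).nullMeasurableSet)
    hmono ⟨2, one_lt_two, (hp.isBounded_strongRegion two_pos).measure_lt_top.ne⟩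

lemma exists_ball_strong {κ : ℝ} (hκ : 1 < κ) :
    ∃ r > 0, ∃ a > 0, ∀ x ∈ Metric.ball (0 : Plane) r,
      a ≤ p.prL (p.dist3 ‖x‖) ∧ p.peak ≤ κ * p.zetaL (p.dist3 ‖x‖) := by
  obtain ⟨w₀, hLw₀, hpiece, hpos⟩ := hp.prL_pos
  have hdist : Tendsto (fun x : Plane => p.dist3 ‖x‖) (𝓝 0) (𝓝 p.L) := by
    simpa [Function.comp_def, hp.dist3_zero] using
      (p.continuous_dist3.comp continuous_norm).tendsto (0 : Plane)
  have hzeta : Tendsto (fun x : Plane => κ * p.zetaOneL (p.dist3 ‖x‖)) (𝓝 0) (𝓝 (κ * p.peak)) :=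
    (((continuousAt_id.rpow_const (Or.inl hp.L_pos.ne')).tendsto.comp hdist).const_mul
      _).const_mul κ
  obtain ⟨r, hr, hball⟩ := Metric.eventually_nhds_iff_ball.1
    ((hdist.eventually (gt_mem_nhds hLw₀)).and
      (hzeta.eventually (lt_mem_nhds (lt_mul_of_one_lt_left hp.peak_pos hκ))))
  refine ⟨r, hr, p.prL w₀, hpos, fun x hx => ?_⟩
  obtain ⟨hw, hstrong⟩ := hball x hx
  have hfirst : p.piece (p.dist3 ‖x‖) = 0 :=
    nonpos_iff_eq_zero.1 (hpiece ▸ p.monotone_piece hw.le)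
  refine ⟨hp.prL_anti _ _ (p.le_dist3 _) hw.le (hfirst.trans hpiece.symm), ?_⟩
  rw [zetaL, hfirst]
  exact hstrong.le

end Valid

end Params

section Independence

variable {Ω : Type*} [MeasurableSpace Ω] {μ : Measure Ω}

lemma indepFun_apply_restrict_ne {ι E : Type*} [MeasurableSpace E] {m : ι → Ω → E}
    (hm : ∀ i, Measurable (m i)) (h : iIndepFun m μ) (k : ι) :
    IndepFun (m k) (fun ω (i : {i // i ≠ k}) => m i ω) μ := by
  rw [IndepFun_iff_Indep]
  refine indep_of_indep_of_le_left (indep_of_indep_of_le_right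
    (indep_iSup_of_disjoint (fun i => (hm i).comap_le) h
      (disjoint_compl_right (a := ({k} : Set ι)))) ?_) (le_iSup₂_of_le k rfl le_rfl)
  rw [← measurable_iff_comap_le]
  exact @measurable_pi_lambda _ _ _ (_) _ _ fun i =>
    measurable_iff_comap_le.2 (le_iSup₂_of_le i.1 i.2 le_rfl)

variable [IsProbabilityMeasure μ]

lemma indepFun_prodMk_right {α β δ : Type*} [MeasurableSpace α] [MeasurableSpace β]
    [MeasurableSpace δ] {A : Ω → α} {B : Ω → β} {C : Ω → δ} (hA : Measurable A)
    (hB : Measurable B) (hC : Measurable C) (hAB : IndepFun A B μ)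
    (hABC : IndepFun (fun ω => (A ω, B ω)) C μ) : IndepFun A (fun ω => (B ω, C ω)) μ := by
  have hBC : IndepFun B C μ := hABC.comp measurable_snd measurable_id
  have := Measure.isProbabilityMeasure_map (μ := μ) hA.aemeasurable
  have := Measure.isProbabilityMeasure_map (μ := μ) hB.aemeasurable
  have := Measure.isProbabilityMeasure_map (μ := μ) hC.aemeasurable
  rw [indepFun_iff_map_prod_eq_prod_map_map hA.aemeasurable (hB.prodMk hC).aemeasurable,
    (indepFun_iff_map_prod_eq_prod_map_map hB.aemeasurable hC.aemeasurable).1 hBC,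
    ← (measurePreserving_prodAssoc (μ.map A) (μ.map B) (μ.map C)).map_eq,
    ← (indepFun_iff_map_prod_eq_prod_map_map hA.aemeasurable hB.aemeasurable).1 hAB,
    ← (indepFun_iff_map_prod_eq_prod_map_map (hA.prodMk hB).aemeasurable hC.aemeasurable).1 hABC,
    Measure.map_map MeasurableEquiv.prodAssoc.measurable ((hA.prodMk hB).prodMk hC)]
  rfl

lemma expMeasure_lt_ofReal (y : ℝ≥0∞) :
    expMeasure 1 {h : ℝ | y < ENNReal.ofReal h} = expNeg y := by
  have := isProbabilityMeasure_expMeasure one_pos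
  induction y with
  | top => simp
  | coe y =>
    have hset : {h : ℝ | (y : ℝ≥0∞) < ENNReal.ofReal h} = (Iic (y : ℝ))ᶜ := by
      ext h
      rw [← ENNReal.ofReal_coe_nnreal, mem_ofPred_eq, mem_compl_iff, mem_Iic, not_le,
        ENNReal.ofReal_lt_ofReal_iff_of_nonneg y.coe_nonneg]
    have hcdf := cdf_expMeasure_eq one_pos (y : ℝ)
    rw [cdf_eq_real, if_pos y.coe_nonneg, one_mul] at hcdf
    rw [hset, ← ENNReal.ofReal_coe_nnreal, expNeg_ofReal y.coe_nonneg, ← ofReal_measureReal,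
      probReal_compl_eq_one_sub measurableSet_Iic, hcdf, sub_sub_cancel]

lemma measure_lt_ofReal_of_map_eq_expMeasure {Y : Ω → ℝ≥0∞} {h : Ω → ℝ} (hY : Measurable Y)
    (hh : Measurable h) (hlaw : μ.map h = expMeasure 1) (hind : IndepFun Y h μ) :
    μ {ω | Y ω < ENNReal.ofReal (h ω)} = ∫⁻ ω, expNeg (Y ω) ∂μ := by
  have hD : MeasurableSet {z : ℝ≥0∞ × ℝ | z.1 < ENNReal.ofReal z.2} :=
    measurableSet_lt measurable_fst measurable_snd.ennreal_ofReal
  have htail : ∀ y : ℝ≥0∞, MeasurableSet {t : ℝ | y < ENNReal.ofReal t} := fun y =>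
    measurableSet_lt measurable_const ENNReal.measurable_ofReal
  rw [← lintegral_indicator_one (measurableSet_lt hY hh.ennreal_ofReal)]
  refine (lintegral_prodMk_of_indepFun hY hh hind
    (K := {z : ℝ≥0∞ × ℝ | z.1 < ENNReal.ofReal z.2}.indicator 1)
    (measurable_one.indicator hD)).trans (lintegral_congr fun ω => ?_)
  rw [← expMeasure_lt_ofReal, ← hlaw, Measure.map_apply hh (htail _)]
  exact lintegral_indicator_one (hh (htail _))

end Independence

lemma measurable_sInf_nat {Ω : Type*} [MeasurableSpace Ω] {S : Ω → Set ℕ}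
    (hS : ∀ i, MeasurableSet {ω | i ∈ S ω}) : Measurable fun ω => sInf (S ω) := by
  classical
  have hempty : MeasurableSet {ω | ∀ j, j ∉ S ω} := by
    rw [ofPred_forall]
    exact MeasurableSet.iInter fun j => (hS j).compl
  have hex : ∀ ω, ∃ i, i ∈ S ω ∨ ∀ j, j ∉ S ω := fun ω => by
    by_cases h : ∃ i, i ∈ S ω
    exacts [h.imp fun _ => Or.inl, ⟨0, Or.inr (not_exists.1 h)⟩]
  convert measurable_find hex fun i => (hS i).union hempty using 2 with ω
  rcases (S ω).eq_empty_or_nonempty with h | h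
  · exact (h ▸ Nat.sInf_empty).trans
      ((Nat.find_eq_zero _).2 (Or.inr (eq_empty_iff_forall_notMem.1 h))).symm
  · have hne : ¬ ∀ j, j ∉ S ω := fun hall => hall _ h.some_mem
    simp only [hne, or_false]
    exact Nat.sInf_def h

namespace Network

variable {Ω : Type*} (N : Network Ω) (p : Params)

open Classical in
/-- Aggregate interference from the active BSs other than the `k`-th one, `k` being fixed. -/
def interferenceExcept (k : ℕ) (ω : Ω) : ℝ≥0∞ :=
  ∑' i, if N.active i ω = true ∧ i ≠ k then
    ENNReal.ofReal (p.P * N.pathLoss p i ω * N.fading i ω) else 0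

/-- The channel gain above which the SINR exceeds `γ` when the user is served by the `k`-th BS. -/
def threshold (γ : ℝ) (k : ℕ) (ω : Ω) : ℝ≥0∞ :=
  ENNReal.ofReal γ * (N.interferenceExcept p k ω + ENNReal.ofReal p.PN) /
    ENNReal.ofReal (p.P * N.pathLoss p k ω)

/-- All the random elements of the network but the `k`-th channel gain. -/
def exceptFading (k : ℕ) (ω : Ω) : (ℝ × ({i // i ≠ k} → ℝ × ℝ)) × (ℕ → Plane × Bool) :=
  ((N.unif k ω, fun i => (N.unif i ω, N.fading i ω)), fun i => (N.bs i ω, N.active i ω))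

/-- The `σ`-algebra generated by all the random elements of the network but the `k`-th channel
gain, which is independent of the `k`-th channel gain in the model. -/
abbrev sigmaExceptFading (k : ℕ) : MeasurableSpace Ω :=
  MeasurableSpace.comap (N.exceptFading k) inferInstance

variable {N p}

lemma lt_sinr_iff (hp : p.Valid) {γ : ℝ} (hγ : 0 < γ) (ω : Ω) :
    ENNReal.ofReal γ < N.sinr p ω ↔
      N.threshold p γ (N.serving p ω) ω < ENNReal.ofReal (N.fading (N.serving p ω) ω) := by
  have hpos : 0 < p.P * N.pathLoss p (N.serving p ω) ω :=
    mul_pos hp.P_pos (hp.linkLoss_pos _ _)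
  have hint : N.interference p ω = N.interferenceExcept p (N.serving p ω) ω := rfl
  rw [sinr, ENNReal.lt_div_iff_mul_lt (Or.inr ENNReal.ofReal_ne_top)
    (Or.inr (ENNReal.ofReal_pos.2 hγ).ne'), threshold, ENNReal.div_lt_iff
    (Or.inl (ENNReal.ofReal_pos.2 hpos).ne') (Or.inl ENNReal.ofReal_ne_top), hint,
    ENNReal.ofReal_mul hpos.le, mul_comm (ENNReal.ofReal (N.fading _ _))]

section Measurability

variable {mΩ : MeasurableSpace Ω}

lemma measurable_pathLoss (hp : p.Valid) (hb : ∀ i, Measurable (N.bs i))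
    (hu : ∀ i, Measurable (N.unif i)) (i : ℕ) : Measurable (N.pathLoss p i) :=
  hp.measurable_linkLoss.comp ((hb i).prodMk (hu i))

lemma measurable_serving (hp : p.Valid) (hb : ∀ i, Measurable (N.bs i))
    (hu : ∀ i, Measurable (N.unif i)) : Measurable (N.serving p) := by
  refine measurable_sInf_nat (S := fun ω => {i | ∀ j, N.pathLoss p j ω ≤ N.pathLoss p i ω})
    fun i => ?_
  change MeasurableSet {ω | ∀ j, N.pathLoss p j ω ≤ N.pathLoss p i ω}
  rw [ofPred_forall]
  exact MeasurableSet.iInter fun j =>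
    measurableSet_le (measurable_pathLoss hp hb hu j) (measurable_pathLoss hp hb hu i)

lemma measurable_threshold (hp : p.Valid) (hb : ∀ i, Measurable (N.bs i))
    (ha : ∀ i, Measurable (N.active i)) (hu : ∀ i, Measurable (N.unif i)) (γ : ℝ) {k : ℕ}
    (hf : ∀ i ≠ k, Measurable (N.fading i)) : Measurable (N.threshold p γ k) := by
  have hpl := measurable_pathLoss hp hb hu
  have hI : Measurable (N.interferenceExcept p k) := by
    refine Measurable.tsum fun i => ?_
    rcases eq_or_ne i k with rfl | hik
    · simp
    · exact Measurable.ite ((ha i (measurableSet_singleton true)).inter (MeasurableSet.const _))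
        (((hpl i).const_mul _).mul (hf i hik)).ennreal_ofReal measurable_const
  exact ((hI.add_const _).const_mul _).div ((hpl k).const_mul _).ennreal_ofReal

lemma measurable_exceptFading_sigma (N : Network Ω) (k : ℕ) :
    Measurable[N.sigmaExceptFading k] (N.exceptFading k) :=
  comap_measurable _

lemma measurable_unif_sigma (N : Network Ω) (k i : ℕ) :
    Measurable[N.sigmaExceptFading k] (N.unif i) := by
  have hZ := N.measurable_exceptFading_sigma k
  rcases eq_or_ne i k with rfl | hik
  · exact hZ.fst.fst
  · exact ((measurable_pi_apply (⟨i, hik⟩ : {i // i ≠ k})).comp hZ.fst.snd).fst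

lemma measurable_fading_sigma (N : Network Ω) {k i : ℕ} (hik : i ≠ k) :
    Measurable[N.sigmaExceptFading k] (N.fading i) :=
  ((measurable_pi_apply (⟨i, hik⟩ : {i // i ≠ k})).comp
    (N.measurable_exceptFading_sigma k).fst.snd).snd

lemma measurable_bs_sigma (N : Network Ω) (k i : ℕ) :
    Measurable[N.sigmaExceptFading k] (N.bs i) :=
  ((measurable_pi_apply i).comp (N.measurable_exceptFading_sigma k).snd).fst

lemma measurable_active_sigma (N : Network Ω) (k i : ℕ) :
    Measurable[N.sigmaExceptFading k] (N.active i) :=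
  ((measurable_pi_apply i).comp (N.measurable_exceptFading_sigma k).snd).snd

end Measurability

open Classical in
/-- The threshold of the `k`-th BS where it is the serving one, infinite elsewhere. -/
def servingThreshold (N : Network Ω) (p : Params) (γ : ℝ) (k : ℕ) (ω : Ω) : ℝ≥0∞ :=
  if N.serving p ω = k then N.threshold p γ k ω else ∞

lemma measurable_servingThreshold_sigma (hp : p.Valid) (γ : ℝ) (k : ℕ) :
    Measurable[N.sigmaExceptFading k] (N.servingThreshold p γ k) := by
  have hb := N.measurable_bs_sigma k
  have hu := N.measurable_unif_sigma k
  exact Measurable.ite (measurable_serving hp hb hu (measurableSet_singleton k))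
    (measurable_threshold hp hb (N.measurable_active_sigma k) hu γ fun i hi =>
      N.measurable_fading_sigma hi) measurable_const

namespace IsModel

variable [MeasurableSpace Ω] {μ : Measure Ω} {lam rho : ℝ}

lemma measurable_mark (h : N.IsModel p μ lam rho) (i : ℕ) :
    Measurable fun ω => (N.unif i ω, N.fading i ω) :=
  (h.measurable_unif i).prodMk (h.measurable_fading i)

lemma measurable_point (h : N.IsModel p μ lam rho) (i : ℕ) :
    Measurable fun ω => (N.bs i ω, N.active i ω) :=
  (h.measurable_bs i).prodMk (h.measurable_active i)

lemma sigmaExceptFading_le (h : N.IsModel p μ lam rho) (k : ℕ) :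
    N.sigmaExceptFading k ≤ ‹MeasurableSpace Ω› :=
  Measurable.comap_le (Measurable.prodMk
    ((h.measurable_unif k).prodMk (measurable_pi_lambda _ fun i => h.measurable_mark i))
    (measurable_pi_lambda _ h.measurable_point))

lemma measurable_servingThreshold (h : N.IsModel p μ lam rho) (hp : p.Valid) (γ : ℝ) (k : ℕ) :
    Measurable (N.servingThreshold p γ k) :=
  (measurable_servingThreshold_sigma hp γ k).mono (h.sigmaExceptFading_le k) le_rfl

variable [IsProbabilityMeasure μ]

lemma indepFun_exceptFading (h : N.IsModel p μ lam rho) (k : ℕ) :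
    IndepFun (N.fading k) (N.exceptFading k) μ := by
  have hothers : Measurable fun ω (i : {i // i ≠ k}) => (N.unif i ω, N.fading i ω) :=
    measurable_pi_lambda _ fun i => h.measurable_mark i
  have hmarks : IndepFun (N.fading k)
      (fun ω => (N.unif k ω, fun i : {i // i ≠ k} => (N.unif i ω, N.fading i ω))) μ :=
    indepFun_prodMk_right (h.measurable_fading k) (h.measurable_unif k) hothers
      (h.unif_indep_fading k).symm
      ((indepFun_apply_restrict_ne h.measurable_mark h.marks_indep k).comp measurable_swap
        measurable_id)
  refine indepFun_prodMk_right (h.measurable_fading k) (h.measurable_unif k |>.prodMk hothers)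
    (measurable_pi_lambda _ h.measurable_point) hmarks ?_
  exact h.marks_indep_bs.symm.comp (φ := fun z : ℕ → ℝ × ℝ =>
    ((z k).2, ((z k).1, fun i : {i // i ≠ k} => z i))) (by fun_prop) measurable_id

lemma measure_servingThreshold_lt (h : N.IsModel p μ lam rho) (hp : p.Valid) (γ : ℝ) (k : ℕ) :
    μ {ω | N.servingThreshold p γ k ω < ENNReal.ofReal (N.fading k ω)} =
      ∫⁻ ω, expNeg (N.servingThreshold p γ k ω) ∂μ := by
  refine measure_lt_ofReal_of_map_eq_expMeasure (h.measurable_servingThreshold hp γ k)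
    (h.measurable_fading k) (h.fading_law k) ?_
  rw [IndepFun_iff_Indep]
  exact indep_of_indep_of_le_left
    ((IndepFun_iff_Indep _ _ _).1 (h.indepFun_exceptFading k).symm)
    (measurable_servingThreshold_sigma hp γ k).comap_le

lemma measure_lt_sinr (h : N.IsModel p μ lam rho) (hp : p.Valid) {γ : ℝ} (hγ : 0 < γ) :
    μ {ω | ENNReal.ofReal γ < N.sinr p ω} =
      ∫⁻ ω, expNeg (N.threshold p γ (N.serving p ω) ω) ∂μ := by
  have hmeas := h.measurable_servingThreshold hp γ
  let T : ℕ → Set Ω := fun k => {ω | N.servingThreshold p γ k ω < ENNReal.ofReal (N.fading k ω)}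
  have hserving : ∀ {k ω}, ω ∈ T k → N.serving p ω = k := fun {k ω} hω => by
    by_contra hne
    have hlt : N.servingThreshold p γ k ω < ENNReal.ofReal (N.fading k ω) := hω
    rw [servingThreshold, if_neg hne] at hlt
    exact not_top_lt hlt
  have hunion : {ω | ENNReal.ofReal γ < N.sinr p ω} = ⋃ k, T k := by
    ext ω
    rw [mem_iUnion, mem_ofPred_eq, lt_sinr_iff hp hγ]
    refine ⟨fun hlt => ⟨N.serving p ω, ?_⟩, fun ⟨k, hk⟩ => ?_⟩
    · simpa [T, servingThreshold] using hlt
    · obtain rfl := hserving hk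
      simpa [T, servingThreshold] using hk
  rw [hunion, measure_iUnion
    (fun k l hkl => Set.disjoint_left.2 fun ω hk hl => hkl ((hserving hk).symm.trans (hserving hl)))
    fun k => measurableSet_lt (hmeas k) (h.measurable_fading k).ennreal_ofReal]
  simp_rw [T, h.measure_servingThreshold_lt hp]
  rw [← lintegral_tsum (f := fun k ω => expNeg (N.servingThreshold p γ k ω))
    fun k => (measurable_expNeg.comp (hmeas k)).aemeasurable]
  refine lintegral_congr fun ω => ?_
  rw [tsum_eq_single (N.serving p ω) fun k hk => by simp [servingThreshold, hk.symm]]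
  simp [servingThreshold]

end IsModel

end Network

lemma expNeg_ofReal_mul {κ : ℝ} (hκ : 0 < κ) (x : ℝ≥0∞) :
    expNeg (ENNReal.ofReal κ * x) = expNeg x ^ κ := by
  induction x with
  | top =>
    rw [ENNReal.mul_top (ENNReal.ofReal_pos.2 hκ).ne', expNeg_top, ENNReal.zero_rpow_of_pos hκ]
  | coe x =>
    rw [← ENNReal.ofReal_coe_nnreal, ← ENNReal.ofReal_mul hκ.le, expNeg_ofReal x.coe_nonneg,
      expNeg_ofReal (mul_nonneg hκ.le x.coe_nonneg), ENNReal.ofReal_rpow_of_pos (Real.exp_pos _),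
      ← Real.exp_mul, neg_mul, mul_comm]

lemma lintegral_expNeg_rpow_le {Ω : Type*} [MeasurableSpace Ω] {μ : Measure Ω}
    [IsProbabilityMeasure μ] {X : Ω → ℝ≥0∞} (hX : Measurable X) {κ : ℝ} (hκ : 1 ≤ κ) :
    (∫⁻ ω, expNeg (X ω) ∂μ) ^ κ ≤ ∫⁻ ω, expNeg (ENNReal.ofReal κ * X ω) ∂μ := by
  have hκ₀ : 0 < κ := one_pos.trans_le hκ
  have hnorm := eLpNorm'_le_eLpNorm'_of_exponent_le one_pos hκ μ
    (measurable_expNeg.comp hX).aestronglyMeasurable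
  simp only [eLpNorm', enorm_eq_self, ENNReal.rpow_one, Function.comp_apply, one_div, inv_one]
    at hnorm
  simp_rw [expNeg_ofReal_mul hκ₀]
  exact (ENNReal.le_rpow_inv_iff hκ₀).1 hnorm

lemma lintegral_expNeg_le_add_measure {Ω : Type*} [MeasurableSpace Ω] {μ : Measure Ω}
    {X Y : Ω → ℝ≥0∞} {A : Set Ω} (hX : Measurable X) (hle : ∀ ω ∉ A, X ω ≤ Y ω) :
    ∫⁻ ω, expNeg (Y ω) ∂μ ≤ ∫⁻ ω, expNeg (X ω) ∂μ + μ A :=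
  calc ∫⁻ ω, expNeg (Y ω) ∂μ ≤ ∫⁻ ω, (expNeg (X ω) + A.indicator 1 ω) ∂μ := by
        refine lintegral_mono fun ω => ?_
        by_cases hω : ω ∈ A
        · rw [indicator_of_mem hω]
          exact (expNeg_le_one _).trans le_add_self
        · exact (antitone_expNeg (hle ω hω)).trans le_self_add
    _ = ∫⁻ ω, expNeg (X ω) ∂μ + ∫⁻ ω, A.indicator 1 ω ∂μ :=
        lintegral_add_left (measurable_expNeg.comp hX) _
    _ ≤ ∫⁻ ω, expNeg (X ω) ∂μ + μ A := by
        gcongr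
        exact lintegral_indicator_one_le _

lemma lintegral_expNeg_expMeasure {t : ℝ} (ht : 0 ≤ t) :
    ∫⁻ h, expNeg (ENNReal.ofReal (t * h)) ∂(expMeasure 1) = ENNReal.ofReal (1 / (1 + t)) := by
  have hpdf : ∀ r, Measurable (exponentialPDF r) := fun r =>
    (measurable_exponentialPDFReal r).ennreal_ofReal
  have hmul : ∀ x, (exponentialPDF 1 * fun h => expNeg (ENNReal.ofReal (t * h))) x =
      ENNReal.ofReal (1 / (1 + t)) * exponentialPDF (1 + t) x := fun x => by
    rw [Pi.mul_apply]
    rcases lt_or_ge x 0 with hx | hx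
    · simp [exponentialPDF_of_neg hx]
    · rw [exponentialPDF_of_nonneg hx, exponentialPDF_of_nonneg hx,
        expNeg_ofReal (mul_nonneg ht hx), ← ENNReal.ofReal_mul (by positivity),
        ← ENNReal.ofReal_mul (by positivity)]
      congr 1
      rw [show -((1 + t) * x) = -(1 * x) + -(t * x) by ring, Real.exp_add]
      field_simp
  calc ∫⁻ h, expNeg (ENNReal.ofReal (t * h)) ∂(expMeasure 1)
      = ∫⁻ x, (exponentialPDF 1 * fun h => expNeg (ENNReal.ofReal (t * h))) x :=
        lintegral_withDensity_eq_lintegral_mul _ (hpdf 1) (by fun_prop)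
    _ = ENNReal.ofReal (1 / (1 + t)) := by
        simp_rw [hmul]
        rw [lintegral_const_mul _ (hpdf _),
          lintegral_exponentialPDF_eq_one (add_pos_of_pos_of_nonneg one_pos ht), mul_one]

lemma lintegral_Icc_ite_lt {a : ℝ} (ha : a ∈ Icc (0 : ℝ) 1) (x y : ℝ≥0∞) :
    ∫⁻ u in Icc (0 : ℝ) 1, (if u < a then x else y) =
      ENNReal.ofReal a * x + ENNReal.ofReal (1 - a) * y := by
  have hbelow : Iio a ∩ Icc (0 : ℝ) 1 = Ico 0 a := by
    ext u
    simp only [mem_inter_iff, mem_Iio, mem_Icc, mem_Ico]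
    exact ⟨fun h => ⟨h.2.1, h.1⟩, fun h => ⟨h.2, h.1, h.2.le.trans ha.2⟩⟩
  have habove : (Iio a)ᶜ ∩ Icc (0 : ℝ) 1 = Icc a 1 := by
    rw [compl_Iio, ← Ici_inter_Iic, ← inter_assoc, Ici_inter_Ici, sup_eq_left.2 ha.1,
      Ici_inter_Iic]
  have hpiecewise :
      (fun u => if u < a then x else y) = (Iio a).piecewise (fun _ => x) fun _ => y := rfl
  rw [hpiecewise, lintegral_piecewise measurableSet_Iio, setLIntegral_const, setLIntegral_const,
    Measure.restrict_apply measurableSet_Iio, Measure.restrict_apply measurableSet_Iio.compl,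
    hbelow, habove, Real.volume_Ico, Real.volume_Icc, sub_zero, mul_comm x, mul_comm y]

/-- The law of the marks of a BS: a uniform variable, which decides whether its link is LoS, and an
independent exponential one, the channel gain. -/
def markLaw : Measure (ℝ × ℝ) := (volume.restrict (Icc (0 : ℝ) 1)).prod (expMeasure 1)

instance isProbabilityMeasure_markLaw : IsProbabilityMeasure markLaw := by
  have := isProbabilityMeasure_expMeasure one_pos
  have : IsProbabilityMeasure (volume.restrict (Icc (0 : ℝ) 1)) := ⟨by simp⟩
  exact inferInstanceAs (IsProbabilityMeasure (Measure.prod _ _))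

lemma markLaw_Iio_prod_univ_pos {a : ℝ} (ha : 0 < a) : 0 < markLaw (Iio a ×ˢ univ) := by
  have := isProbabilityMeasure_expMeasure one_pos
  rw [markLaw, Measure.prod_prod, measure_univ, mul_one, Measure.restrict_apply measurableSet_Iio]
  have hsub : Ioo 0 (min a 1) ⊆ Iio a ∩ Icc (0 : ℝ) 1 := fun u hu =>
    ⟨hu.2.trans_le (min_le_left _ _), hu.1.le, (hu.2.trans_le (min_le_right _ _)).le⟩
  refine lt_of_lt_of_le ?_ (measure_mono hsub)
  simp [ha]

namespace Params

variable (p : Params)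

/-- The power received from a BS at `z.1`, with marks `z.2`. -/
def receivedPower (z : Plane × ℝ × ℝ) : ℝ≥0∞ :=
  ENNReal.ofReal (p.P * p.linkLoss z.1 z.2.1 * z.2.2)

/-- The LoS and NLoS interference integrands together, without the Jacobian factor `r` of polar
coordinates. -/
def attenuation (γ r : ℝ) : ℝ :=
  p.prL (p.dist3 r) / (1 + (p.s γ * p.P * p.zetaL (p.dist3 r))⁻¹) +
    (1 - p.prL (p.dist3 r)) / (1 + (p.s γ * p.P * p.zetaNL (p.dist3 r))⁻¹)

/-- The integral of the attenuation over the plane. -/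
def totalAttenuation (γ : ℝ) : ℝ≥0∞ := ∫⁻ x : Plane, ENNReal.ofReal (p.attenuation γ ‖x‖)

/-- The exponent of the Laplace transform, at `p.s γ`, of the noise plus the power received from an
active process of density `δ`. -/
def laplaceExponent (γ δ : ℝ) : ℝ≥0∞ :=
  ENNReal.ofReal (p.s γ * p.PN) + ENNReal.ofReal δ * p.totalAttenuation γ

namespace Valid

variable {p} (hp : p.Valid) {γ : ℝ}

include hp

lemma s_pos (hγ : 0 < γ) : 0 < p.s γ := div_pos hγ (mul_pos hp.P_pos hp.peak_pos)

lemma measurable_receivedPower : Measurable p.receivedPower := by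
  have hloss : Measurable fun z : Plane × ℝ × ℝ => p.linkLoss z.1 z.2.1 :=
    hp.measurable_linkLoss.comp (measurable_fst.prodMk measurable_snd.fst)
  exact ((hloss.const_mul _).mul measurable_snd.snd).ennreal_ofReal

lemma attenuation_mem_Icc (hγ : 0 < γ) (r : ℝ) : p.attenuation γ r ∈ Icc (0 : ℝ) 1 := by
  obtain ⟨hpr₀, hpr₁⟩ := hp.prL_mem _ (p.le_dist3 r)
  have hs := mul_pos (hp.s_pos hγ) hp.P_pos
  have hL : 0 ≤ (p.s γ * p.P * p.zetaL (p.dist3 r))⁻¹ :=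
    (inv_pos.2 (mul_pos hs (hp.zetaL_pos r))).le
  have hNL : 0 ≤ (p.s γ * p.P * p.zetaNL (p.dist3 r))⁻¹ :=
    (inv_pos.2 (mul_pos hs (hp.zetaNL_pos r))).le
  refine ⟨add_nonneg (div_nonneg hpr₀ (by linarith)) (div_nonneg (by linarith) (by linarith)), ?_⟩
  calc p.attenuation γ r ≤ p.prL (p.dist3 r) + (1 - p.prL (p.dist3 r)) :=
        add_le_add (div_le_self hpr₀ (by linarith)) (div_le_self (by linarith) (by linarith))
    _ = 1 := add_sub_cancel _ _

lemma lintegral_expNeg_receivedPower (hγ : 0 < γ) (x : Plane) :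
    ∫⁻ e, expNeg (ENNReal.ofReal (p.s γ) * p.receivedPower (x, e)) ∂markLaw =
      ENNReal.ofReal (1 - p.attenuation γ ‖x‖) := by
  have := isProbabilityMeasure_expMeasure one_pos
  have hs := mul_pos (hp.s_pos hγ) hp.P_pos
  have hL := mul_pos hs (hp.zetaL_pos ‖x‖)
  have hNL := mul_pos hs (hp.zetaNL_pos ‖x‖)
  obtain ⟨hpr₀, hpr₁⟩ := hp.prL_mem _ (p.le_dist3 ‖x‖)
  have hmeas : Measurable fun e => expNeg (ENNReal.ofReal (p.s γ) * p.receivedPower (x, e)) :=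
    measurable_expNeg.comp ((hp.measurable_receivedPower.comp measurable_prodMk_left).const_mul _)
  have hgain : ∀ u, ∫⁻ h, expNeg (ENNReal.ofReal (p.s γ) * p.receivedPower (x, u, h))
      ∂(expMeasure 1) = if u < p.prL (p.dist3 ‖x‖)
        then ENNReal.ofReal (1 / (1 + p.s γ * p.P * p.zetaL (p.dist3 ‖x‖)))
        else ENNReal.ofReal (1 / (1 + p.s γ * p.P * p.zetaNL (p.dist3 ‖x‖))) := fun u => by
    simp_rw [receivedPower, ← ENNReal.ofReal_mul (hp.s_pos hγ).le, ← mul_assoc]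
    rw [lintegral_expNeg_expMeasure (mul_pos hs (hp.linkLoss_pos x u)).le, linkLoss]
    split_ifs <;> rfl
  rw [markLaw, lintegral_prod _ hmeas.aemeasurable]
  simp_rw [hgain]
  rw [lintegral_Icc_ite_lt ⟨hpr₀, hpr₁⟩, ← ENNReal.ofReal_mul hpr₀,
    ← ENNReal.ofReal_mul (by linarith), ← ENNReal.ofReal_add (by positivity)
      (mul_nonneg (by linarith) (by positivity)), attenuation]
  have hinv : ∀ t : ℝ, 0 < t → 1 / (1 + t) = 1 - 1 / (1 + t⁻¹) := fun t ht => by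
    field_simp
    ring
  rw [hinv _ hL, hinv _ hNL]
  ring_nf

lemma lintegral_one_sub_expNeg_receivedPower (hγ : 0 < γ) :
    ∫⁻ x, (1 - ∫⁻ e, expNeg (ENNReal.ofReal (p.s γ) * p.receivedPower (x, e)) ∂markLaw) =
      p.totalAttenuation γ := by
  refine lintegral_congr fun x => ?_
  rw [hp.lintegral_expNeg_receivedPower hγ, ← ENNReal.ofReal_one,
    ← ENNReal.ofReal_sub _ (sub_nonneg.2 (hp.attenuation_mem_Icc hγ _).2), sub_sub_cancel]

lemma activeDensity_nonneg {lam rho : ℝ} (hlam : 0 < lam) (hrho : 0 < rho) :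
    0 ≤ p.activeDensity lam rho := by
  have hq := hp.q_pos
  have hbase : 1 ≤ (1 + rho / (p.q * lam)) ^ p.q :=
    Real.one_le_rpow (le_add_of_nonneg_right (by positivity)) hq.le
  exact mul_nonneg hlam.le (sub_nonneg.2 (div_le_one_of_le₀ hbase (by positivity)))

-- With `t = 1 / λ`, the density is a difference quotient at `0` of `t ↦ -(1 + ρ t / q) ^ (-q)`.
lemma tendsto_activeDensity (rho : ℝ) :
    Tendsto (fun lam => p.activeDensity lam rho) atTop (𝓝 rho) := by
  have hq := hp.q_pos
  have hderiv : HasDerivAt (fun t : ℝ => -((1 + rho / p.q * t) ^ p.q)⁻¹) rho 0 := by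
    have hlin : HasDerivAt (fun t : ℝ => 1 + rho / p.q * t) (rho / p.q) 0 := by
      simpa using ((hasDerivAt_id (0 : ℝ)).const_mul (rho / p.q)).const_add 1
    refine ((hlin.rpow_const (p := p.q) (Or.inl (by simp))).fun_inv
      (by simp)).fun_neg.congr_deriv ?_
    simp only [mul_zero, add_zero, Real.one_rpow]
    field_simp
  refine (hderiv.tendsto_slope_zero_right.comp tendsto_inv_atTop_nhdsGT_zero).congr'
    (.of_forall fun lam => ?_)
  have hquot : rho / p.q * lam⁻¹ = rho / (p.q * lam) := by rw [← div_eq_mul_inv, div_div]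
  simp only [Function.comp, activeDensity, smul_eq_mul, inv_inv, zero_add, mul_zero, add_zero,
    Real.one_rpow, hquot]
  ring

end Valid

end Params

namespace Network

variable {Ω : Type*}

/-- The locations and marks of all BSs, as a random counting measure. -/
def links (N : Network Ω) : Ω → Measure (Plane × ℝ × ℝ) :=
  pointMeasure (fun _ _ => true) fun i ω => (N.bs i ω, N.unif i ω, N.fading i ω)

/-- The locations and marks of the active BSs, as a random counting measure. -/
def activeLinks (N : Network Ω) : Ω → Measure (Plane × ℝ × ℝ) :=
  pointMeasure N.active fun i ω => (N.bs i ω, N.unif i ω, N.fading i ω)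

/-- The power received from all active BSs, whether serving or not. -/
def totalPower (N : Network Ω) (p : Params) (ω : Ω) : ℝ≥0∞ :=
  ∫⁻ z, p.receivedPower z ∂N.activeLinks ω

/-- The channel gain above which the SINR would exceed `γ` if the user were served by an inactive
BS over the strongest possible link. -/
def idealThreshold (N : Network Ω) (p : Params) (γ : ℝ) (ω : Ω) : ℝ≥0∞ :=
  ENNReal.ofReal γ * (N.totalPower p ω + ENNReal.ofReal p.PN) / ENNReal.ofReal (p.P * p.peak)

/-- The event that the path loss of the serving link is below `peak / κ`. -/
def weakServing (N : Network Ω) (p : Params) (κ : ℝ) : Set Ω :=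
  {ω | κ * N.pathLoss p (N.serving p ω) ω < p.peak}

/-- The event that some active BS might have a path loss of at least `peak / κ`. -/
def strongActive (N : Network Ω) (p : Params) (κ : ℝ) : Set Ω :=
  {ω | N.activeLinks ω (p.strongRegion κ ×ˢ univ) ≠ 0}

variable {N : Network Ω} {p : Params}

lemma totalPower_eq_tsum (hp : p.Valid) (ω : Ω) :
    N.totalPower p ω = ∑' i, if N.active i ω = true then
      ENNReal.ofReal (p.P * N.pathLoss p i ω * N.fading i ω) else 0 :=
  lintegral_pointMeasure hp.measurable_receivedPower ω

lemma interferenceExcept_le_totalPower (hp : p.Valid) (k : ℕ) (ω : Ω) :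
    N.interferenceExcept p k ω ≤ N.totalPower p ω := by
  classical
  rw [totalPower_eq_tsum hp]
  refine ENNReal.tsum_le_tsum fun i => ?_
  split_ifs with hik hi
  exacts [le_rfl, (hi hik.1).elim, zero_le, le_rfl]

lemma interferenceExcept_eq_totalPower (hp : p.Valid) {k : ℕ} {ω : Ω}
    (hk : ¬ N.active k ω = true) : N.interferenceExcept p k ω = N.totalPower p ω := by
  classical
  rw [totalPower_eq_tsum hp]
  refine tsum_congr fun i => if_congr (and_iff_left_of_imp ?_) rfl rfl
  rintro hi rfl
  exact hk hi

lemma idealThreshold_le_threshold (hp : p.Valid) (γ : ℝ) {k : ℕ} {ω : Ω}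
    (hk : ¬ N.active k ω = true) : N.idealThreshold p γ ω ≤ N.threshold p γ k ω := by
  rw [threshold, interferenceExcept_eq_totalPower hp hk]
  have hP := hp.P_pos.le
  have hpeak : N.pathLoss p k ω ≤ p.peak := hp.linkLoss_le_peak _ _
  unfold idealThreshold
  gcongr

lemma threshold_le_mul_idealThreshold (hp : p.Valid) (γ : ℝ) {κ : ℝ} (hκ : 0 ≤ κ) {k : ℕ} {ω : Ω}
    (hk : p.peak ≤ κ * N.pathLoss p k ω) :
    N.threshold p γ k ω ≤ ENNReal.ofReal κ * N.idealThreshold p γ ω := by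
  have hpeak : 0 < p.P * p.peak := mul_pos hp.P_pos hp.peak_pos
  have hpower : ENNReal.ofReal (p.P * p.peak) ≤
      ENNReal.ofReal κ * ENNReal.ofReal (p.P * N.pathLoss p k ω) := by
    rw [← ENNReal.ofReal_mul hκ, mul_left_comm]
    exact ENNReal.ofReal_le_ofReal (mul_le_mul_of_nonneg_left hk hp.P_pos.le)
  refine ENNReal.div_le_of_le_mul ?_
  calc ENNReal.ofReal γ * (N.interferenceExcept p k ω + ENNReal.ofReal p.PN)
      ≤ ENNReal.ofReal γ * (N.totalPower p ω + ENNReal.ofReal p.PN) := by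
        gcongr
        exact interferenceExcept_le_totalPower hp k ω
    _ = N.idealThreshold p γ ω * ENNReal.ofReal (p.P * p.peak) :=
        (ENNReal.div_mul_cancel (ENNReal.ofReal_pos.2 hpeak).ne' ENNReal.ofReal_ne_top).symm
    _ ≤ N.idealThreshold p γ ω *
          (ENNReal.ofReal κ * ENNReal.ofReal (p.P * N.pathLoss p k ω)) := by gcongr
    _ = ENNReal.ofReal κ * N.idealThreshold p γ ω * ENNReal.ofReal (p.P * N.pathLoss p k ω) := by
        ring

lemma idealThreshold_eq_lintegral (hp : p.Valid) (γ : ℝ) (ω : Ω) :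
    N.idealThreshold p γ ω =
      ∫⁻ z, ENNReal.ofReal (p.s γ) * p.receivedPower z ∂N.activeLinks ω +
        ENNReal.ofReal (p.s γ * p.PN) := by
  have hpeak : 0 < p.P * p.peak := mul_pos hp.P_pos hp.peak_pos
  rw [lintegral_const_mul _ hp.measurable_receivedPower, ENNReal.ofReal_mul' hp.PN_nonneg,
    ← mul_add, idealThreshold, ENNReal.mul_div_right_comm, ← ENNReal.ofReal_div_of_pos hpeak]
  rfl

lemma exists_forall_pathLoss_le (hp : p.Valid) {ω : Ω}
    (hfin : ∀ n : ℕ, pointMeasure (fun _ _ => true) N.bs ω (Metric.ball 0 n) < ∞) :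
    ∃ i, ∀ j, N.pathLoss p j ω ≤ N.pathLoss p i ω := by
  have h₀ : 0 < N.pathLoss p 0 ω := hp.linkLoss_pos _ _
  obtain ⟨R, hR⟩ := (hp.isBounded_strongRegion (div_pos hp.peak_pos h₀)).subset_ball 0
  obtain ⟨n, hn⟩ := exists_nat_ge R
  have hsub : {j | N.pathLoss p 0 ω ≤ N.pathLoss p j ω} ⊆
      {j | true = true ∧ N.bs j ω ∈ Metric.ball 0 n} := fun j hj => by
    refine ⟨rfl, Metric.ball_subset_ball hn (hR (Params.mem_strongRegion (u := N.unif j ω)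
      (div_pos hp.peak_pos h₀).le ?_))⟩
    rw [div_mul_eq_mul_div, le_div_iff₀ h₀]
    exact mul_le_mul_of_nonneg_left hj hp.peak_pos.le
  have hball := hfin n
  rw [pointMeasure_apply measurableSet_ball, ENat.toENNReal_lt_top, Set.encard_lt_top_iff] at hball
  obtain ⟨i, hi, hmax⟩ := exists_max_image _ (fun j => N.pathLoss p j ω) (hball.subset hsub)
    ⟨0, le_refl (N.pathLoss p 0 ω)⟩
  refine ⟨i, fun j => ?_⟩
  rcases le_total (N.pathLoss p 0 ω) (N.pathLoss p j ω) with hj | hj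
  exacts [hmax j hj, hj.trans hi]

lemma pathLoss_le_serving {ω : Ω} (h : ∃ i, ∀ j, N.pathLoss p j ω ≤ N.pathLoss p i ω) (j : ℕ) :
    N.pathLoss p j ω ≤ N.pathLoss p (N.serving p ω) ω :=
  Nat.sInf_mem (s := {i | ∀ j, N.pathLoss p j ω ≤ N.pathLoss p i ω}) h j

lemma not_active_serving {κ : ℝ} (hκ : 0 ≤ κ) {ω : Ω} (hweak : ω ∉ N.weakServing p κ)
    (hstrong : ω ∉ N.strongActive p κ) : ¬ N.active (N.serving p ω) ω = true := fun hactive =>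
  (pointMeasure_apply_eq_zero_iff ((p.measurableSet_strongRegion κ).prod .univ)).1
    (not_not.1 hstrong) _ hactive ⟨Params.mem_strongRegion hκ (not_lt.1 hweak), trivial⟩

lemma links_eq_zero_of_weakServing {κ : ℝ} (hκ : 0 ≤ κ) {r a : ℝ}
    (hball : ∀ x ∈ Metric.ball (0 : Plane) r,
      a ≤ p.prL (p.dist3 ‖x‖) ∧ p.peak ≤ κ * p.zetaL (p.dist3 ‖x‖)) {ω : Ω}
    (hmax : ∃ i, ∀ j, N.pathLoss p j ω ≤ N.pathLoss p i ω) (hω : ω ∈ N.weakServing p κ) :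
    N.links ω (Metric.ball 0 r ×ˢ Iio a ×ˢ univ) = 0 := by
  refine (pointMeasure_apply_eq_zero_iff
    (measurableSet_ball.prod (measurableSet_Iio.prod .univ))).2 fun i _ hi => ?_
  have hlt : κ * N.pathLoss p (N.serving p ω) ω < p.peak := hω
  refine hlt.not_ge ?_
  obtain ⟨hpr, hzeta⟩ := hball _ hi.1
  have hLoS : N.pathLoss p i ω = p.zetaL (p.dist3 ‖N.bs i ω‖) := if_pos (hi.2.1.trans_le hpr)
  exact (hLoS ▸ hzeta).trans (mul_le_mul_of_nonneg_left (pathLoss_le_serving hmax i) hκ)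

namespace IsModel

variable [MeasurableSpace Ω] {μ : Measure Ω} {lam rho : ℝ}

lemma isPoissonEnumeration_bs (h : N.IsModel p μ lam rho) (hlam : 0 ≤ lam) :
    IsPoissonEnumeration μ lam (fun _ _ => true) N.bs where
  measurable_act _ := measurable_const
  measurable_loc := h.measurable_bs
  injective := h.bs_injective
  density_nonneg := hlam
  isHPPP := by
    have hset : pointSet (fun _ _ => true) N.bs = N.bsSet := by
      funext ω
      simp [pointSet, bsSet]
    exact hset ▸ h.bs_poisson

lemma isPoissonEnumeration_active (h : N.IsModel p μ lam rho)
    (hdens : 0 ≤ p.activeDensity lam rho) :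
    IsPoissonEnumeration μ (p.activeDensity lam rho) N.active N.bs where
  measurable_act := h.measurable_active
  measurable_loc := h.measurable_bs
  injective := h.bs_injective
  density_nonneg := hdens
  isHPPP := h.active_poisson

lemma measurable_threshold_serving (h : N.IsModel p μ lam rho) (hp : p.Valid) (γ : ℝ) :
    Measurable fun ω => N.threshold p γ (N.serving p ω) ω := by
  have hjoint : Measurable fun z : ℕ × Ω => N.threshold p γ z.1 z.2 :=
    measurable_from_prod_countable_right fun _ => measurable_threshold hp h.measurable_bs
      h.measurable_active h.measurable_unif γ fun i _ => h.measurable_fading i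
  exact hjoint.comp ((measurable_serving hp h.measurable_bs h.measurable_unif).prodMk measurable_id)

lemma measurable_idealThreshold (h : N.IsModel p μ lam rho) (hp : p.Valid) (γ : ℝ) :
    Measurable (N.idealThreshold p γ) :=
  (((measurable_lintegral_pointMeasure h.measurable_active
    (fun i => (h.measurable_bs i).prodMk (h.measurable_mark i))
    hp.measurable_receivedPower).add_const _).const_mul _).div_const _

lemma measurableSet_strongActive (h : N.IsModel p μ lam rho) (κ : ℝ) :
    MeasurableSet (N.strongActive p κ) :=
  measurableSet_eq_fun ((Measure.measurable_coe ((p.measurableSet_strongRegion κ).prod .univ)).comp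
    (measurable_pointMeasure h.measurable_active
      fun i => (h.measurable_bs i).prodMk (h.measurable_mark i))) measurable_const |>.compl

variable [IsProbabilityMeasure μ]

lemma map_mark (h : N.IsModel p μ lam rho) (i : ℕ) :
    μ.map (fun ω => (N.unif i ω, N.fading i ω)) = markLaw := by
  have := isProbabilityMeasure_expMeasure one_pos
  have := Measure.isProbabilityMeasure_map (μ := μ) (h.measurable_fading i).aemeasurable
  rw [(indepFun_iff_map_prod_eq_prod_map_map (h.measurable_unif i).aemeasurable
    (h.measurable_fading i).aemeasurable).1 (h.unif_indep_fading i), h.unif_law, h.fading_law,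
    markLaw]

lemma isIndependentMarking_active (h : N.IsModel p μ lam rho) :
    IsIndependentMarking μ markLaw N.active N.bs fun i ω => (N.unif i ω, N.fading i ω) :=
  ⟨h.measurable_mark, h.map_mark, h.marks_indep, h.marks_indep_bs⟩

lemma isIndependentMarking_bs (h : N.IsModel p μ lam rho) :
    IsIndependentMarking μ markLaw (fun _ _ => true) N.bs
      fun i ω => (N.unif i ω, N.fading i ω) :=
  ⟨h.measurable_mark, h.map_mark, h.marks_indep, h.marks_indep_bs.comp
    (φ := fun (z : ℕ → Plane × Bool) (i : ℕ) => ((z i).1, true))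
    (measurable_pi_lambda _ fun i => by fun_prop) measurable_id⟩

lemma ae_exists_forall_pathLoss_le (h : N.IsModel p μ lam rho) (hp : p.Valid) (hlam : 0 ≤ lam) :
    ∀ᵐ ω ∂μ, ∃ i, ∀ j, N.pathLoss p j ω ≤ N.pathLoss p i ω := by
  filter_upwards [ae_all_iff.2 fun n : ℕ => (h.isPoissonEnumeration_bs hlam).ae_pointMeasure_lt_top
    measurableSet_ball (Metric.isBounded_ball (x := (0 : Plane)) (r := n))] with ω hω
    using exists_forall_pathLoss_le hp hω

lemma measure_weakServing_le (h : N.IsModel p μ lam rho) (hp : p.Valid) (hlam : 0 ≤ lam)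
    {κ : ℝ} (hκ : 0 ≤ κ) {r a : ℝ}
    (hball : ∀ x ∈ Metric.ball (0 : Plane) r,
      a ≤ p.prL (p.dist3 ‖x‖) ∧ p.peak ≤ κ * p.zetaL (p.dist3 ‖x‖)) :
    μ (N.weakServing p κ) ≤ expNeg (ENNReal.ofReal lam *
      (volume.prod markLaw) (Metric.ball (0 : Plane) r ×ˢ Iio a ×ˢ univ)) := by
  rw [← (h.isPoissonEnumeration_bs hlam).measure_marked_eq_zero h.isIndependentMarking_bs
    (measurableSet_ball.prod (measurableSet_Iio.prod .univ))]
  refine measure_mono_ae ?_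
  filter_upwards [h.ae_exists_forall_pathLoss_le hp hlam] with ω hmax hω
    using links_eq_zero_of_weakServing hκ hball hmax hω

lemma measure_strongActive (h : N.IsModel p μ lam rho) (hdens : 0 ≤ p.activeDensity lam rho)
    (κ : ℝ) : μ (N.strongActive p κ) =
      1 - expNeg (ENNReal.ofReal (p.activeDensity lam rho) * volume (p.strongRegion κ)) := by
  have hvoid := (h.isPoissonEnumeration_active hdens).measure_marked_eq_zero
    h.isIndependentMarking_active ((p.measurableSet_strongRegion κ).prod .univ)
  rw [Measure.prod_prod, measure_univ, mul_one] at hvoid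
  have hS := h.measurableSet_strongActive κ
  have hcompl : (N.strongActive p κ)ᶜ =
      {ω | N.activeLinks ω (p.strongRegion κ ×ˢ univ) = 0} := by
    ext ω
    exact not_not
  rw [← hvoid, ← compl_compl (N.strongActive p κ), prob_compl_eq_one_sub hS.compl, hcompl]
  rfl

lemma lintegral_expNeg_idealThreshold (h : N.IsModel p μ lam rho) (hp : p.Valid)
    (hdens : 0 ≤ p.activeDensity lam rho) {γ : ℝ} (hγ : 0 < γ) :
    ∫⁻ ω, expNeg (N.idealThreshold p γ ω) ∂μ =
      expNeg (p.laplaceExponent γ (p.activeDensity lam rho)) := by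
  have hF := hp.measurable_receivedPower.const_mul (ENNReal.ofReal (p.s γ))
  have hpower := (h.isPoissonEnumeration_active hdens).lintegral_expNeg_marked
    h.isIndependentMarking_active hF
  have hmeas : Measurable fun ω => expNeg
      (∫⁻ z, ENNReal.ofReal (p.s γ) * p.receivedPower z ∂N.activeLinks ω) :=
    measurable_expNeg.comp (measurable_lintegral_pointMeasure h.measurable_active
      (fun i => (h.measurable_bs i).prodMk (h.measurable_mark i)) hF)
  simp_rw [idealThreshold_eq_lintegral hp, expNeg_add]
  rw [lintegral_mul_const _ hmeas]
  simp_rw [activeLinks]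
  rw [hpower, hp.lintegral_one_sub_expNeg_receivedPower hγ, ← expNeg_add, add_comm,
    Params.laplaceExponent]

lemma measure_lt_sinr_le (h : N.IsModel p μ lam rho) (hp : p.Valid)
    (hdens : 0 ≤ p.activeDensity lam rho) {γ : ℝ} (hγ : 0 < γ) {κ : ℝ} (hκ : 0 ≤ κ) :
    μ {ω | ENNReal.ofReal γ < N.sinr p ω} ≤
      expNeg (p.laplaceExponent γ (p.activeDensity lam rho)) +
        μ (N.weakServing p κ ∪ N.strongActive p κ) := by
  rw [h.measure_lt_sinr hp hγ, ← h.lintegral_expNeg_idealThreshold hp hdens hγ]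
  refine lintegral_expNeg_le_add_measure (h.measurable_idealThreshold hp γ) fun ω hω => ?_
  exact idealThreshold_le_threshold hp γ (not_active_serving hκ (fun hw => hω (Or.inl hw))
    fun hs => hω (Or.inr hs))

lemma expNeg_laplaceExponent_rpow_le (h : N.IsModel p μ lam rho) (hp : p.Valid)
    (hdens : 0 ≤ p.activeDensity lam rho) {γ : ℝ} (hγ : 0 < γ) {κ : ℝ} (hκ : 1 ≤ κ) :
    expNeg (p.laplaceExponent γ (p.activeDensity lam rho)) ^ κ ≤
      μ {ω | ENNReal.ofReal γ < N.sinr p ω} + μ (N.weakServing p κ) := by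
  rw [h.measure_lt_sinr hp hγ, ← h.lintegral_expNeg_idealThreshold hp hdens hγ]
  refine (lintegral_expNeg_rpow_le (h.measurable_idealThreshold hp γ) hκ).trans
    (lintegral_expNeg_le_add_measure (h.measurable_threshold_serving hp γ) fun ω hω => ?_)
  exact threshold_le_mul_idealThreshold hp γ (zero_le_one.trans hκ) (not_lt.1 hω)

end IsModel

end Network

lemma tendsto_expNeg_ofReal_mul_atTop {x : ℝ≥0∞} (hx : x ≠ 0) :
    Tendsto (fun lam : ℝ => expNeg (ENNReal.ofReal lam * x)) atTop (𝓝 0) := by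
  have h : Tendsto (fun lam : ℝ => ENNReal.ofReal lam * x) atTop (𝓝 (∞ * x)) :=
    ENNReal.Tendsto.mul_const ENNReal.tendsto_ofReal_atTop (Or.inl ENNReal.top_ne_zero)
  rw [ENNReal.top_mul hx] at h
  rw [← expNeg_top]
  exact (continuous_expNeg.tendsto ∞).comp h

lemma tendsto_expNeg_rpow_one {x : ℝ≥0∞} (hx : x ≠ ∞) :
    Tendsto (fun κ : ℝ => expNeg x ^ κ) (𝓝 1) (𝓝 (expNeg x)) := by
  have h : Tendsto (fun κ : ℝ => ENNReal.ofReal κ * x) (𝓝 1) (𝓝 x) := by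
    simpa using ENNReal.Tendsto.mul_const (ENNReal.continuous_ofReal.tendsto 1) (Or.inr hx)
  refine ((continuous_expNeg.tendsto x).comp h).congr' ?_
  filter_upwards [eventually_gt_nhds one_pos] with κ hκ using expNeg_ofReal_mul hκ x

namespace Params

variable {p : Params} {γ : ℝ}

lemma laplaceExponent_ne_top (hfin : p.totalAttenuation γ ≠ ∞) (δ : ℝ) :
    p.laplaceExponent γ δ ≠ ∞ :=
  ENNReal.add_ne_top.2 ⟨ENNReal.ofReal_ne_top, ENNReal.mul_ne_top ENNReal.ofReal_ne_top hfin⟩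

lemma continuous_laplaceExponent (hfin : p.totalAttenuation γ ≠ ∞) :
    Continuous (p.laplaceExponent γ) :=
  continuous_const.add ((ENNReal.continuous_mul_const hfin).comp ENNReal.continuous_ofReal)

end Params

namespace Network

variable {p : Params} {γ rho : ℝ} {Ω : ℝ → Type*} [∀ lam, MeasurableSpace (Ω lam)]
  {μ : ∀ lam, Measure (Ω lam)} [∀ lam, IsProbabilityMeasure (μ lam)] {N : ∀ lam, Network (Ω lam)}

lemma tendsto_measure_weakServing (hp : p.Valid)
    (hN : ∀ lam, 0 < lam → (N lam).IsModel p (μ lam) lam rho) {κ : ℝ} (hκ : 1 < κ) :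
    Tendsto (fun lam => μ lam ((N lam).weakServing p κ)) atTop (𝓝 0) := by
  obtain ⟨r, hr, a, ha, hball⟩ := hp.exists_ball_strong hκ
  have hne : (volume.prod markLaw) (Metric.ball (0 : Plane) r ×ˢ Iio a ×ˢ univ) ≠ 0 := by
    rw [Measure.prod_prod]
    exact mul_ne_zero (Metric.measure_ball_pos _ _ hr).ne' (markLaw_Iio_prod_univ_pos ha).ne'
  refine tendsto_of_tendsto_of_tendsto_of_le_of_le' tendsto_const_nhds
    (tendsto_expNeg_ofReal_mul_atTop hne) (Eventually.of_forall fun _ => zero_le) ?_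
  filter_upwards [eventually_gt_atTop 0] with lam hlam
  exact (hN lam hlam).measure_weakServing_le hp hlam.le (zero_le_one.trans hκ.le) hball

lemma tendsto_measure_strongActive (hp : p.Valid) (hrho : 0 < rho)
    (hN : ∀ lam, 0 < lam → (N lam).IsModel p (μ lam) lam rho) {κ : ℝ} (hκ : 0 < κ) :
    Tendsto (fun lam => μ lam ((N lam).strongActive p κ)) atTop
      (𝓝 (1 - expNeg (ENNReal.ofReal rho * volume (p.strongRegion κ)))) := by
  have hfin : volume (p.strongRegion κ) ≠ ∞ :=
    (hp.isBounded_strongRegion hκ).measure_lt_top.ne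
  have hcont : Continuous fun δ : ℝ =>
      1 - expNeg (ENNReal.ofReal δ * volume (p.strongRegion κ)) :=
    (ENNReal.continuous_sub_left ENNReal.one_ne_top).comp (continuous_expNeg.comp
      ((ENNReal.continuous_mul_const hfin).comp ENNReal.continuous_ofReal))
  refine ((hcont.tendsto rho).comp (hp.tendsto_activeDensity rho)).congr' ?_
  filter_upwards [eventually_gt_atTop 0] with lam hlam
  exact ((hN lam hlam).measure_strongActive (hp.activeDensity_nonneg hlam hrho) κ).symm

lemma eventually_lt_measure_lt_sinr (hp : p.Valid) (hγ : 0 < γ) (hrho : 0 < rho)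
    (hfin : p.totalAttenuation γ ≠ ∞)
    (hN : ∀ lam, 0 < lam → (N lam).IsModel p (μ lam) lam rho) {a : ℝ≥0∞}
    (ha : a < expNeg (p.laplaceExponent γ rho)) :
    ∀ᶠ lam in atTop, a < μ lam {ω | ENNReal.ofReal γ < (N lam).sinr p ω} := by
  obtain ⟨κ, haκ, hκ⟩ : ∃ κ : ℝ, a < expNeg (p.laplaceExponent γ rho) ^ κ ∧ 1 < κ :=
    (((tendsto_expNeg_rpow_one (Params.laplaceExponent_ne_top hfin rho)).mono_left
      nhdsWithin_le_nhds).eventually (lt_mem_nhds ha)).and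
      (eventually_mem_nhdsWithin (s := Ioi 1)) |>.exists
  have hexp : Tendsto (fun lam => expNeg (p.laplaceExponent γ (p.activeDensity lam rho)) ^ κ)
      atTop (𝓝 (expNeg (p.laplaceExponent γ rho) ^ κ)) :=
    ((ENNReal.continuous_rpow_const.comp (continuous_expNeg.comp
      (Params.continuous_laplaceExponent hfin))).tendsto rho).comp (hp.tendsto_activeDensity rho)
  have hlower := ENNReal.Tendsto.sub hexp (tendsto_measure_weakServing hp hN hκ)
    (Or.inr ENNReal.zero_ne_top)
  rw [tsub_zero] at hlower
  filter_upwards [hlower.eventually (lt_mem_nhds haκ), eventually_gt_atTop 0] with lam hlt hlam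
  exact hlt.trans_le (tsub_le_iff_right.2 ((hN lam hlam).expNeg_laplaceExponent_rpow_le hp
    (hp.activeDensity_nonneg hlam hrho) hγ hκ.le))

lemma eventually_measure_lt_sinr_lt (hp : p.Valid) (hγ : 0 < γ) (hrho : 0 < rho)
    (hfin : p.totalAttenuation γ ≠ ∞)
    (hN : ∀ lam, 0 < lam → (N lam).IsModel p (μ lam) lam rho) {b : ℝ≥0∞}
    (hb : expNeg (p.laplaceExponent γ rho) < b) :
    ∀ᶠ lam in atTop, μ lam {ω | ENNReal.ofReal γ < (N lam).sinr p ω} < b := by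
  have hregion : Tendsto (fun κ => expNeg (p.laplaceExponent γ rho) +
      (1 - expNeg (ENNReal.ofReal rho * volume (p.strongRegion κ)))) (𝓝[>] 1)
      (𝓝 (expNeg (p.laplaceExponent γ rho) + (1 - expNeg (ENNReal.ofReal rho * 0)))) :=
    ((continuous_const.add ((ENNReal.continuous_sub_left ENNReal.one_ne_top).comp
      (continuous_expNeg.comp (ENNReal.continuous_const_mul ENNReal.ofReal_ne_top)))).tendsto
      0).comp hp.tendsto_volume_strongRegion
  rw [mul_zero, expNeg_zero, tsub_self, add_zero] at hregion
  obtain ⟨κ, hbκ, hκ⟩ :=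
    ((hregion.eventually (gt_mem_nhds hb)).and eventually_mem_nhdsWithin).exists
  have hκ₀ : 0 < κ := one_pos.trans hκ
  have hexp : Tendsto (fun lam => expNeg (p.laplaceExponent γ (p.activeDensity lam rho))) atTop
      (𝓝 (expNeg (p.laplaceExponent γ rho))) :=
    ((continuous_expNeg.comp (Params.continuous_laplaceExponent hfin)).tendsto rho).comp
      (hp.tendsto_activeDensity rho)
  have hupper := hexp.add ((tendsto_measure_weakServing hp hN hκ).add
    (tendsto_measure_strongActive hp hrho hN hκ₀))
  rw [zero_add] at hupper
  filter_upwards [hupper.eventually (gt_mem_nhds hbκ), eventually_gt_atTop 0] with lam hlt hlam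
  refine lt_of_le_of_lt ?_ hlt
  exact ((hN lam hlam).measure_lt_sinr_le hp (hp.activeDensity_nonneg hlam hrho) hγ
    hκ₀.le).trans (by gcongr; exact measure_union_le _ _)

lemma tendsto_measure_lt_sinr (hp : p.Valid) (hγ : 0 < γ) (hrho : 0 < rho)
    (hfin : p.totalAttenuation γ ≠ ∞)
    (hN : ∀ lam, 0 < lam → (N lam).IsModel p (μ lam) lam rho) :
    Tendsto (fun lam => μ lam {ω | ENNReal.ofReal γ < (N lam).sinr p ω}) atTop
      (𝓝 (expNeg (p.laplaceExponent γ rho))) :=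
  tendsto_order.2 ⟨fun _ => eventually_lt_measure_lt_sinr hp hγ hrho hfin hN,
    fun _ => eventually_measure_lt_sinr_lt hp hγ hrho hfin hN⟩

end Network

namespace Params

variable {p : Params} {γ : ℝ}

lemma losIntegrand_add_nlosIntegrand (γ u : ℝ) :
    p.losIntegrand γ u + p.nlosIntegrand γ u = u * p.attenuation γ u := by
  rw [losIntegrand, nlosIntegrand, attenuation]
  ring

lemma c_eq_exp (γ : ℝ) : p.c γ = Real.exp (-(p.s γ * p.PN)) := by
  rw [c, s]
  congr 1
  ring

lemma g_eq_exp (γ : ℝ) : p.g γ = Real.exp (-(2 * Real.pi *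
    ((∫ u in Ioi (0 : ℝ), p.losIntegrand γ u) + ∫ u in Ioi (0 : ℝ), p.nlosIntegrand γ u))) := by
  rw [g, ← Real.exp_add]
  congr 1
  ring

lemma c_pos (γ : ℝ) : 0 < p.c γ := Real.exp_pos _

lemma g_pos (γ : ℝ) : 0 < p.g γ := mul_pos (Real.exp_pos _) (Real.exp_pos _)

namespace Valid

variable (hp : p.Valid) (hγ : 0 < γ)

include hp hγ

lemma totalAttenuation_eq (hLoS : IntegrableOn (p.losIntegrand γ) (Ioi 0))
    (hNLoS : IntegrableOn (p.nlosIntegrand γ) (Ioi 0)) :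
    p.totalAttenuation γ = ENNReal.ofReal (2 * Real.pi *
      ((∫ u in Ioi (0 : ℝ), p.losIntegrand γ u) + ∫ u in Ioi (0 : ℝ), p.nlosIntegrand γ u)) := by
  have hdim : Module.finrank ℝ Plane = 2 := finrank_euclideanSpace_fin
  have hdisk : volume.real (Metric.ball (0 : Plane) 1) = Real.pi := by
    simp [Measure.real, EuclideanSpace.volume_ball_fin_two, Real.pi_pos.le]
  have hpolar : IntegrableOn (fun u => u * p.attenuation γ u) (Ioi 0) := by
    simp_rw [← losIntegrand_add_nlosIntegrand]
    exact hLoS.add hNLoS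
  have hint : Integrable fun x : Plane => p.attenuation γ ‖x‖ := by
    rw [integrable_fun_norm_addHaar, hdim]
    simpa using hpolar
  rw [totalAttenuation, ← ofReal_integral_eq_lintegral_ofReal hint
    (ae_of_all _ fun x => (hp.attenuation_mem_Icc hγ _).1), integral_fun_norm_addHaar volume
      (p.attenuation γ), hdim, hdisk, ← integral_add hLoS hNLoS]
  simp only [losIntegrand_add_nlosIntegrand, Nat.add_one_sub_one, pow_one, nsmul_eq_mul,
    smul_eq_mul, Nat.cast_ofNat, mul_assoc]

lemma losIntegrand_nonneg {u : ℝ} (hu : 0 ≤ u) : 0 ≤ p.losIntegrand γ u := by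
  have hz := mul_pos (mul_pos (hp.s_pos hγ) hp.P_pos) (hp.zetaL_pos u)
  exact div_nonneg (mul_nonneg (hp.prL_mem _ (p.le_dist3 u)).1 hu) (by positivity)

lemma nlosIntegrand_nonneg {u : ℝ} (hu : 0 ≤ u) : 0 ≤ p.nlosIntegrand γ u := by
  have hz := mul_pos (mul_pos (hp.s_pos hγ) hp.P_pos) (hp.zetaNL_pos u)
  exact div_nonneg (mul_nonneg (sub_nonneg.2 (hp.prL_mem _ (p.le_dist3 u)).2) hu) (by positivity)

lemma exists_losIntegrand_pos : ∃ r > 0, ∀ u ∈ Ioo 0 r, 0 < p.losIntegrand γ u := by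
  obtain ⟨r, hr, a, ha, hball⟩ := hp.exists_ball_strong one_lt_two
  refine ⟨r, hr, fun u hu => ?_⟩
  have hnorm : ‖EuclideanSpace.single (0 : Fin 2) u‖ = u := by simp [abs_of_pos hu.1]
  have hpr : a ≤ p.prL (p.dist3 u) := by
    simpa only [hnorm] using (hball (EuclideanSpace.single 0 u)
      (mem_ball_zero_iff.2 (hnorm.trans_lt hu.2))).1
  have hz := mul_pos (mul_pos (hp.s_pos hγ) hp.P_pos) (hp.zetaL_pos u)
  exact div_pos (mul_pos (ha.trans_le hpr) hu.1) (by positivity)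

lemma setIntegral_losIntegrand_pos (hLoS : IntegrableOn (p.losIntegrand γ) (Ioi 0)) :
    0 < ∫ u in Ioi (0 : ℝ), p.losIntegrand γ u := by
  rw [setIntegral_pos_iff_support_of_nonneg_ae
    (ae_restrict_of_forall_mem measurableSet_Ioi fun _ hu =>
      hp.losIntegrand_nonneg hγ (le_of_lt hu)) hLoS]
  obtain ⟨r, hr, hpos⟩ := hp.exists_losIntegrand_pos hγ
  have hvol : 0 < volume (Ioo 0 r) := by simpa using hr
  exact hvol.trans_le (measure_mono fun u hu => ⟨(hpos u hu).ne', hu.1⟩)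

lemma integral_losIntegrand_add_integral_nlosIntegrand_pos
    (hLoS : IntegrableOn (p.losIntegrand γ) (Ioi 0)) :
    0 < (∫ u in Ioi (0 : ℝ), p.losIntegrand γ u) + ∫ u in Ioi (0 : ℝ), p.nlosIntegrand γ u :=
  add_pos_of_pos_of_nonneg (hp.setIntegral_losIntegrand_pos hγ hLoS)
    (setIntegral_nonneg measurableSet_Ioi fun _ hu => hp.nlosIntegrand_nonneg hγ (le_of_lt hu))

lemma g_lt_one (hLoS : IntegrableOn (p.losIntegrand γ) (Ioi 0)) : p.g γ < 1 := by
  rw [g_eq_exp, Real.exp_lt_one_iff, neg_lt_zero]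
  exact mul_pos Real.two_pi_pos (hp.integral_losIntegrand_add_integral_nlosIntegrand_pos hγ hLoS)

lemma expNeg_totalAttenuation (hLoS : IntegrableOn (p.losIntegrand γ) (Ioi 0))
    (hNLoS : IntegrableOn (p.nlosIntegrand γ) (Ioi 0)) :
    expNeg (p.totalAttenuation γ) = ENNReal.ofReal (p.g γ) := by
  rw [hp.totalAttenuation_eq hγ hLoS hNLoS, expNeg_ofReal (mul_pos Real.two_pi_pos
    (hp.integral_losIntegrand_add_integral_nlosIntegrand_pos hγ hLoS)).le, g_eq_exp]

lemma expNeg_laplaceExponent (hLoS : IntegrableOn (p.losIntegrand γ) (Ioi 0))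
    (hNLoS : IntegrableOn (p.nlosIntegrand γ) (Ioi 0)) {rho : ℝ} (hrho : 0 < rho) :
    expNeg (p.laplaceExponent γ rho) = ENNReal.ofReal (p.c γ * p.g γ ^ rho) := by
  rw [laplaceExponent, expNeg_add, expNeg_ofReal_mul hrho,
    expNeg_ofReal (mul_nonneg (hp.s_pos hγ).le hp.PN_nonneg), ← c_eq_exp,
    hp.expNeg_totalAttenuation hγ hLoS hNLoS, ENNReal.ofReal_rpow_of_pos (g_pos γ),
    ← ENNReal.ofReal_mul (c_pos γ).le]

lemma strictAnti_c_mul_g_rpow (hLoS : IntegrableOn (p.losIntegrand γ) (Ioi 0)) :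
    StrictAnti fun rho : ℝ => p.c γ * p.g γ ^ rho := fun _ _ h =>
  mul_lt_mul_of_pos_left
    (Real.rpow_lt_rpow_of_exponent_gt (g_pos γ) (hp.g_lt_one hγ hLoS) h) (c_pos γ)

end Valid

end Params

lemma Network.tendsto_pcov {p : Params} {γ rho : ℝ} {Ω : ℝ → Type*}
    [∀ lam, MeasurableSpace (Ω lam)] {μ : ∀ lam, Measure (Ω lam)}
    [∀ lam, IsProbabilityMeasure (μ lam)] {N : ∀ lam, Network (Ω lam)} (hp : p.Valid)
    (hγ : 0 < γ) (hrho : 0 < rho) (hLoS : IntegrableOn (p.losIntegrand γ) (Ioi 0))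
    (hNLoS : IntegrableOn (p.nlosIntegrand γ) (Ioi 0))
    (hN : ∀ lam, 0 < lam → (N lam).IsModel p (μ lam) lam rho) :
    Tendsto (fun lam => (N lam).pcov p (μ lam) γ) atTop (𝓝 (p.c γ * p.g γ ^ rho)) := by
  have hfin : p.totalAttenuation γ ≠ ∞ :=
    hp.totalAttenuation_eq hγ hLoS hNLoS ▸ ENNReal.ofReal_ne_top
  have hlim := tendsto_measure_lt_sinr hp hγ hrho hfin hN
  rw [hp.expNeg_laplaceExponent hγ hLoS hNLoS hrho] at hlim
  have hpos : 0 < p.c γ * p.g γ ^ rho :=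
    mul_pos (Params.c_pos γ) (Real.rpow_pos_of_pos (Params.g_pos γ) rho)
  have hreal := (ENNReal.tendsto_toReal ENNReal.ofReal_ne_top).comp hlim
  rwa [ENNReal.toReal_ofReal hpos.le] at hreal

end SmallCell

end

theorem lemma2 (p : SmallCell.Params) (hp : p.Valid) (γ : ℝ) (hγ : 0 < γ)
    (hLoS : IntegrableOn (p.losIntegrand γ) (Ioi 0))
    (hNLoS : IntegrableOn (p.nlosIntegrand γ) (Ioi 0))
    (Ω : ℝ → ℝ → Type*) [∀ lam rho, MeasurableSpace (Ω lam rho)]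
    (μ : ∀ lam rho, Measure (Ω lam rho)) [∀ lam rho, IsProbabilityMeasure (μ lam rho)]
    (N : ∀ lam rho, SmallCell.Network (Ω lam rho))
    (hN : ∀ lam rho, 0 < lam → 0 < rho → (N lam rho).IsModel p (μ lam rho) lam rho) :
    (∀ rho, 0 < rho →
      Tendsto (fun lam => (N lam rho).pcov p (μ lam rho) γ) atTop (𝓝 (p.c γ * p.g γ ^ rho))) ∧
    StrictAntiOn (fun rho => limUnder atTop (fun lam => (N lam rho).pcov p (μ lam rho) γ))
      (Ioi 0) := by
  have hlim : ∀ rho, 0 < rho →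
      Tendsto (fun lam => (N lam rho).pcov p (μ lam rho) γ) atTop (𝓝 (p.c γ * p.g γ ^ rho)) :=
    fun rho hrho => SmallCell.Network.tendsto_pcov (N := fun lam => N lam rho)
      (μ := fun lam => μ lam rho) hp hγ hrho hLoS hNLoS fun lam hlam => hN lam rho hlam hrho
  refine ⟨hlim, fun r₁ h₁ r₂ h₂ hlt => ?_⟩
  simp only [(hlim r₁ h₁).limUnder_eq, (hlim r₂ h₂).limUnder_eq]
  exact hp.strictAnti_c_mul_g_rpow hγ hLoS hlt
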